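/- Let $R$ be a commutative ring. All functors below are covariant functors on the category of commutative $R$-algebras, and $\mathcal R$ denotes the functor of rings $\mathcal R(S)=S$. A \emph{functor of $\mathcal R$-modules} $\mathbb M$ is a functor such that each $\mathbb M(S)$ is an $S$-module, with functorial addition and scalar multiplication; a morphism $\mathbb M\to\mathbb M'$ is a natural transformation whose components are $S$-linear, and $\operatorname{Hom}_{\mathcal R}(\mathbb M,\mathbb M')$ is the collection of these. A \emph{functor of $\mathcal R$-algebras} $\mathbb A$ is a functor of (associative, unital) rings with a morphism of functors of rings $\mathcal R\to\mathbb A$ such that $S$ has central image in $\mathbb A(S)$ for every $S$; morphisms of these are the natural transformations whose components are morphisms of $S$-algebras. Let $\mathbb{H}om_{\mathcal R}(\mathbb M,\mathbb M')$ be the functor of $\mathcal R$-modules $S\mapsto \operatorname{Hom}_{\mathcal S}(\mathbb M_{|S},\mathbb M'_{|S})$, where $\mathbb M_{|S}$ is the restriction of $\mathbb M$ to commutative $S$-algebras, and let $\mathbb M^*=\mathbb{H}om_{\mathcal R}(\mathbb M,\mathcal R)$. Products, direct sums and tensor products are computed pointwise; in particular $(\mathbb M\otimes_{\mathcal R}\mathbb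 M')(S)=\mathbb M(S)\otimes_S\mathbb M'(S)$. A functor of $\mathcal R$-modules $\mathbb M$ is \emph{reflexive} if the natural morphism $\mathbb M\to\mathbb M^{**}$ is an isomorphism, and it is a \emph{dual functor} if $\mathbb M\simeq\mathbb N^*$ for some functor of $\mathcal R$-modules $\mathbb N$. It is \emph{essentially free} if there are a set $I$ and a set $P$ of subsets of $I$, closed under binary unions, such that $$\mathbb M\simeq\varprojlim_{\alpha\in P}\ \bigoplus_{\alpha}\mathcal R,$$ where $P$ is ordered by inclusion and the transition morphisms for $\alpha\subseteq\beta$ are $(\lambda_i)_{i\in\beta}\mapsto(\lambda_i)_{i\in\alpha}$. Let $\mathfrak F$ be the family of essentially free functors of $\mathcal R$-modules. Then: 1. Every $\mathbb M\in\mathfrak F$ is reflexive. 2. If $L$ is a set and $\mathbb M_l\in\mathfrak F$ for all $l\in L$, then $\prod_{l\in L}\mathbb M_l\in\mathfrak F$ and $\bigoplus_{l\in L}\mathbb M_l\in\mathfrak F$. 3. If $\mathbb M,\mathbb M'\in\mathfrak F$, then $\mathbb M^*\in\mathfrak F$ and $\mathbb{H}om_{\mathcal R}(\mathbb M,\mathbb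 M')\in\mathfrak F$. 4. If $\mathbb M,\mathbb M'\in\mathfrak F$, then $(\mathbb M\otimes_{\mathcal R}\mathbb M')^*\in\mathfrak F$, and for every dual functor of $\mathcal R$-modules $\mathbb M''$ composition with the natural morphism $\mathbb M\otimes_{\mathcal R}\mathbb M'\to(\mathbb M\otimes_{\mathcal R}\mathbb M')^{**}$ is a bijection $$\operatorname{Hom}_{\mathcal R}((\mathbb M\otimes_{\mathcal R}\mathbb M')^{**},\mathbb M'')=\operatorname{Hom}_{\mathcal R}(\mathbb M\otimes_{\mathcal R}\mathbb M',\mathbb M'').$$ 5. If $\mathbb A,\mathbb A'$ are functors of $\mathcal R$-algebras whose underlying functors of $\mathcal R$-modules are in $\mathfrak F$, then $(\mathbb A\otimes_{\mathcal R}\mathbb A')^{**}\in\mathfrak F$, and it carries a structure of functor of $\mathcal R$-algebras, compatible with its structure of functor of $\mathcal R$-modules, such that the natural morphism $\mathbb A\otimes_{\mathcal R}\mathbb A'\to(\mathbb A\otimes_{\mathcal R}\mathbb A')^{**}$ is a morphism of functors of $\mathcal R$-algebras and composition with it is a bijection $$\operatorname{Hom}_{\mathcal R\text{-alg}}((\mathbb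 A\otimes_{\mathcal R}\mathbb A')^{**},\mathbb A'')=\operatorname{Hom}_{\mathcal R\text{-alg}}(\mathbb A\otimes_{\mathcal R}\mathbb A',\mathbb A'')$$ for every functor of $\mathcal R$-algebras $\mathbb A''$ that is a dual functor of $\mathcal R$-modules. -/

import Mathlib

open scoped TensorProduct

universe u w w₁ w₂ w₃

noncomputable section

/-- A functor of `𝓡`-modules: a covariant functor on the category of commutative `R`-algebras
(`R` and the algebras are in `Type u`) such that each `M(S)` is an `S`-module, addition and
scalar multiplication being functorial, i.e. `M(S) → M(T)` is semilinear along `S → T`. The values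
may lie in any universe, so that the internal `Hom` of two such functors is always again one. -/
structure ModuleFunctor (R : Type u) [CommRing R] where
  obj : ∀ (S : Type u) [CommRing S] [Algebra R S], Type w
  [addCommGroup : ∀ (S : Type u) [CommRing S] [Algebra R S], AddCommGroup (obj S)]
  [module : ∀ (S : Type u) [CommRing S] [Algebra R S], Module S (obj S)]
  map : ∀ {S T : Type u} [CommRing S] [Algebra R S] [CommRing T] [Algebra R T]
    (f : S →ₐ[R] T), obj S →ₛₗ[(f : S →+* T)] obj T
  map_id : ∀ (S : Type u) [CommRing S] [Algebra R S] (x : obj S),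
    map (AlgHom.id R S) x = x
  map_comp : ∀ {S T U : Type u} [CommRing S] [Algebra R S] [CommRing T] [Algebra R T]
    [CommRing U] [Algebra R U] (f : S →ₐ[R] T) (g : T →ₐ[R] U) (x : obj S),
    map (g.comp f) x = map g (map f x)

namespace ModuleFunctor

attribute [instance] ModuleFunctor.addCommGroup ModuleFunctor.module

variable {R : Type u} [CommRing R]

/-- Morphisms of functors of `𝓡`-modules. -/
@[ext]
structure Hom (M : ModuleFunctor.{u, w₁} R) (N : ModuleFunctor.{u, w₂} R) where
  app : ∀ (S : Type u) [CommRing S] [Algebra R S], M.obj S →ₗ[S] N.obj S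
  naturality : ∀ {S T : Type u} [CommRing S] [Algebra R S] [CommRing T] [Algebra R T]
    (f : S →ₐ[R] T) (x : M.obj S), app T (M.map f x) = N.map f (app S x)

/-- Composition of morphisms, `g ∘ f`. -/
def Hom.comp {M : ModuleFunctor.{u, w₁} R} {N : ModuleFunctor.{u, w₂} R}
    {L : ModuleFunctor.{u, w₃} R} (g : Hom N L) (f : Hom M N) : Hom M L where
  app S _ _ := (g.app S).comp (f.app S)
  naturality φ x := by simp [f.naturality, g.naturality]

/-- A morphism is an isomorphism iff all its components are bijective (the inverses are then
automatically linear and natural). -/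
def Hom.IsIso {M : ModuleFunctor.{u, w₁} R} {N : ModuleFunctor.{u, w₂} R} (f : Hom M N) : Prop :=
  ∀ (S : Type u) [CommRing S] [Algebra R S], Function.Bijective (f.app S)

/-- `M` and `N` are isomorphic functors of `𝓡`-modules. -/
def Isomorphic (M : ModuleFunctor.{u, w₁} R) (N : ModuleFunctor.{u, w₂} R) : Prop :=
  ∃ f : Hom M N, f.IsIso

variable (R) in
/-- The functor `𝓡`, `𝓡(S) = S`. -/
def base : ModuleFunctor.{u, u} R where
  obj S _ _ := S
  addCommGroup S _ _ := inferInstanceAs (AddCommGroup S)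
  module S _ _ := inferInstanceAs (Module S S)
  map f := { toFun := f, map_add' := map_add f, map_smul' := fun s x => map_mul f s x }
  map_id _ _ _ _ := rfl
  map_comp _ _ _ := rfl

/-- `Hom_𝓢(M_{|S}, N_{|S})`. A commutative `S`-algebra is the same thing as a commutative
`R`-algebra `T` with a morphism of `R`-algebras `f : S → T`, and a morphism of `S`-algebras is a
morphism of `R`-algebras `g` compatible with these. -/
@[ext]
structure HomOver (M : ModuleFunctor.{u, w₁} R) (N : ModuleFunctor.{u, w₂} R)
    (S : Type u) [CommRing S] [Algebra R S] where
  app : ∀ (T : Type u) [CommRing T] [Algebra R T] (_ : S →ₐ[R] T), M.obj T →ₗ[T] N.obj T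
  naturality : ∀ {T U : Type u} [CommRing T] [Algebra R T] [CommRing U] [Algebra R U]
    (f : S →ₐ[R] T) (g : T →ₐ[R] U) (x : M.obj T),
    app U (g.comp f) (M.map g x) = N.map g (app T f x)

namespace HomOver

variable {M : ModuleFunctor.{u, w₁} R} {N : ModuleFunctor.{u, w₂} R}
  {S : Type u} [CommRing S] [Algebra R S]

instance : Zero (HomOver M N S) where
  zero := ⟨fun _ _ _ _ => 0, by simp⟩

instance : Add (HomOver M N S) where
  add a b := ⟨fun T _ _ f => a.app T f + b.app T f, by simp [a.naturality, b.naturality]⟩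

instance : Neg (HomOver M N S) where
  neg a := ⟨fun T _ _ f => - a.app T f, by simp [a.naturality]⟩

/-- `s ∈ S` acts on an `S`-algebra `f : S → T` as `f s`. -/
instance : SMul S (HomOver M N S) where
  smul s a := ⟨fun T _ _ f => f s • a.app T f, by simp [a.naturality]⟩

@[simp] theorem zero_app (T : Type u) [CommRing T] [Algebra R T] (f : S →ₐ[R] T) :
    (0 : HomOver M N S).app T f = 0 := rfl

@[simp] theorem add_app (a b : HomOver M N S) (T : Type u) [CommRing T] [Algebra R T]
    (f : S →ₐ[R] T) : (a + b).app T f = a.app T f + b.app T f := rfl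

@[simp] theorem neg_app (a : HomOver M N S) (T : Type u) [CommRing T] [Algebra R T]
    (f : S →ₐ[R] T) : (-a).app T f = - a.app T f := rfl

@[simp] theorem smul_app (s : S) (a : HomOver M N S) (T : Type u) [CommRing T] [Algebra R T]
    (f : S →ₐ[R] T) : (s • a).app T f = f s • a.app T f := rfl

theorem ext_app {a b : HomOver M N S}
    (h : ∀ (T : Type u) [CommRing T] [Algebra R T] (f : S →ₐ[R] T), a.app T f = b.app T f) :
    a = b := by
  apply HomOver.ext
  funext T i j f
  exact h T f

instance : AddCommGroup (HomOver M N S) where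
  add_assoc a b c := ext_app fun T _ _ f => by simp [add_assoc]
  zero_add a := ext_app fun T _ _ f => by simp
  add_zero a := ext_app fun T _ _ f => by simp
  add_comm a b := ext_app fun T _ _ f => by simp [add_comm]
  neg_add_cancel a := ext_app fun T _ _ f => by simp
  nsmul := nsmulRec
  zsmul := zsmulRec

instance : Module S (HomOver M N S) where
  one_smul a := ext_app fun T _ _ f => by simp
  mul_smul s t a := ext_app fun T _ _ f => by simp [mul_smul]
  smul_zero s := ext_app fun T _ _ f => by simp
  smul_add s a b := ext_app fun T _ _ f => by simp
  add_smul s t a := ext_app fun T _ _ f => by simp [add_smul]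
  zero_smul a := ext_app fun T _ _ f => by simp

end HomOver

/-- The internal `Hom`, the functor `S ↦ Hom_𝓢(M_{|S}, N_{|S})`. -/
def ihom (M : ModuleFunctor.{u, w₁} R) (N : ModuleFunctor.{u, w₂} R) :
    ModuleFunctor.{u, max (u + 1) w₁ w₂} R where
  obj S _ _ := HomOver M N S
  map h :=
    { toFun := fun a => ⟨fun T _ _ f => a.app T (f.comp h), fun f g x => by
        rw [AlgHom.comp_assoc, a.naturality]⟩
      map_add' := fun _ _ => rfl
      map_smul' := fun _ _ => rfl }
  map_id _ _ _ _ := rfl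
  map_comp _ _ _ := rfl

/-- The dual `M^* = Hom(M, 𝓡)`. -/
def dual (M : ModuleFunctor.{u, w} R) : ModuleFunctor.{u, max (u + 1) w} R :=
  ihom M (base R)

/-- The natural morphism `M → M^{**}`, `m ↦ (φ ↦ φ m)`. -/
def toBidual (M : ModuleFunctor.{u, w} R) : Hom M M.dual.dual where
  app S _ _ :=
    { toFun := fun m =>
        ⟨fun T _ _ f =>
          { toFun := fun φ => HomOver.app φ T (AlgHom.id R T) (M.map f m)
            map_add' := fun _ _ => rfl
            map_smul' := fun _ _ => rfl },
        fun {T U} _ _ _ _ f g φ => by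
          have h := HomOver.naturality φ (AlgHom.id R T) g (M.map f m)
          rw [← M.map_comp, AlgHom.comp_id] at h
          exact h⟩
      map_add' := fun m n => HomOver.ext_app fun T _ _ f => LinearMap.ext fun φ => by
        change HomOver.app φ T (AlgHom.id R T) (M.map f (m + n)) =
          HomOver.app φ T (AlgHom.id R T) (M.map f m) + HomOver.app φ T (AlgHom.id R T) (M.map f n)
        rw [map_add, map_add]
      map_smul' := fun s m => HomOver.ext_app fun T _ _ f => LinearMap.ext fun φ => by
        change HomOver.app φ T (AlgHom.id R T) (M.map f (s • m)) =
          f s • HomOver.app φ T (AlgHom.id R T) (M.map f m)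
        rw [map_smulₛₗ, map_smul]
        rfl }
  naturality {S T} _ _ _ _ f m := HomOver.ext_app fun U _ _ g => LinearMap.ext fun φ => by
    change HomOver.app φ U (AlgHom.id R U) (M.map g (M.map f m)) =
      HomOver.app φ U (AlgHom.id R U) (M.map (g.comp f) m)
    rw [M.map_comp]

/-- `M` is reflexive if the natural morphism `M → M^{**}` is an isomorphism. -/
def IsReflexive (M : ModuleFunctor.{u, w} R) : Prop := M.toBidual.IsIso

/-- `M` is a dual functor of `𝓡`-modules if it is (isomorphic to) `N^*` for some functor of
`𝓡`-modules `N`. -/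
def IsDual (M : ModuleFunctor.{u, w₁} R) : Prop :=
  ∃ N : ModuleFunctor.{u, w₂} R, Isomorphic M N.dual

/-- Products, computed pointwise. -/
def prod {L : Type u} (M : L → ModuleFunctor.{u, w} R) : ModuleFunctor.{u, max u w} R where
  obj S _ _ := ∀ l, (M l).obj S
  map f :=
    { toFun := fun x l => (M l).map f (x l)
      map_add' := fun _ _ => funext fun _ => map_add _ _ _
      map_smul' := fun _ _ => funext fun _ => map_smulₛₗ _ _ _ }
  map_id S _ _ x := funext fun l => (M l).map_id S (x l)
  map_comp f g x := funext fun l => (M l).map_comp f g (x l)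

/-- Direct sums, computed pointwise. -/
def directSum {L : Type u} (M : L → ModuleFunctor.{u, w} R) : ModuleFunctor.{u, max u w} R where
  obj S _ _ := DirectSum L fun l => (M l).obj S
  map f :=
    { toFun := fun x => DFinsupp.mapRange (fun l y => (M l).map f y) (fun _ => map_zero _) x
      map_add' := fun x y => DFinsupp.mapRange_add _ _ (fun _ => map_add _) x y
      map_smul' := fun s x => DFinsupp.ext fun l => (M l).map f |>.map_smulₛₗ s (x l) }
  map_id S _ _ x := DFinsupp.ext fun l => (M l).map_id S (x l)
  map_comp f g x := DFinsupp.ext fun l => (M l).map_comp f g (x l)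

/-- The tensor product `(M ⊗ N)(S) = M(S) ⊗_S N(S)`. -/
def tensor (M : ModuleFunctor.{u, w₁} R) (N : ModuleFunctor.{u, w₂} R) :
    ModuleFunctor.{u, max w₁ w₂} R where
  obj S _ _ := M.obj S ⊗[S] N.obj S
  map f := TensorProduct.map (M.map f) (N.map f)
  map_id S _ _ x := by
    induction x with
    | zero => exact map_zero _
    | tmul m n => exact congrArg₂ (· ⊗ₜ[S] ·) (M.map_id S m) (N.map_id S n)
    | add x y hx hy => rw [map_add, hx, hy]
  map_comp f g x := by
    induction x with
    | zero => simp only [map_zero]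
    | tmul m n => simp [M.map_comp, N.map_comp]
    | add x y hx hy => simp only [map_add, hx, hy]

/-- For a set `P` of subsets of `I`, the inverse limit over `α ∈ P`, ordered by inclusion, of the
`S`-modules `⨁_α S`, the transition map for `α ⊆ β` being `(λ_i)_{i ∈ β} ↦ (λ_i)_{i ∈ α}`. -/
def limFreeSubmodule {I : Type u} (P : Set (Set I)) (S : Type u) [CommRing S] :
    Submodule S (∀ α : P, (α.1 →₀ S)) where
  carrier := {x | ∀ (α β : P) (h : α.1 ⊆ β.1) (i : α.1), x α i = x β ⟨i.1, h i.2⟩}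
  add_mem' {x y} hx hy α β h i := by
    simp only [Pi.add_apply, Finsupp.add_apply, hx α β h i, hy α β h i]
  zero_mem' _ _ _ _ := rfl
  smul_mem' s x hx α β h i := by
    simp only [Pi.smul_apply, Finsupp.smul_apply, hx α β h i]

/-- The functor of `𝓡`-modules `lim_{α ∈ P} ⨁_α 𝓡`. -/
def limFree {I : Type u} (P : Set (Set I)) : ModuleFunctor.{u, u} R where
  obj S _ _ := limFreeSubmodule P S
  addCommGroup S _ _ := inferInstanceAs (AddCommGroup (limFreeSubmodule P S))
  module S _ _ := inferInstanceAs (Module S (limFreeSubmodule P S))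
  map f :=
    { toFun := fun x => ⟨fun α => Finsupp.mapRange f (map_zero f) (x.1 α), fun α β h i => by
        simp only [Finsupp.mapRange_apply, x.2 α β h i]⟩
      map_add' := fun x y => Subtype.ext <| funext fun α => Finsupp.ext fun i =>
        map_add f (x.1 α i) (y.1 α i)
      map_smul' := fun s x => Subtype.ext <| funext fun α => Finsupp.ext fun i =>
        map_mul f s (x.1 α i) }
  map_id S _ _ x := Subtype.ext <| funext fun α => Finsupp.ext fun i => rfl
  map_comp f g x := Subtype.ext <| funext fun α => Finsupp.ext fun i => rfl

/-- `M` is essentially free (`M ∈ 𝔉`): it is isomorphic to the inverse limit over `α ∈ P` of the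
`⨁_α 𝓡`, for some set `I` and some set `P` of subsets of `I` that is closed under binary
unions. -/
def IsEssentiallyFree (M : ModuleFunctor.{u, w} R) : Prop :=
  ∃ (I : Type u) (P : Set (Set I)),
    (∀ α ∈ P, ∀ β ∈ P, α ∪ β ∈ P) ∧ Isomorphic M (limFree P)

end ModuleFunctor

/-- A functor of `𝓡`-algebras (associative, with unit, not necessarily commutative): a functor of
rings `A` with a morphism of functors of rings `𝓡 → A` such that the image of `S` in `A(S)` is
central. -/
structure AlgebraFunctor (R : Type u) [CommRing R] where
  obj : ∀ (S : Type u) [CommRing S] [Algebra R S], Type w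
  [ring : ∀ (S : Type u) [CommRing S] [Algebra R S], Ring (obj S)]
  [algebra : ∀ (S : Type u) [CommRing S] [Algebra R S], Algebra S (obj S)]
  map : ∀ {S T : Type u} [CommRing S] [Algebra R S] [CommRing T] [Algebra R T]
    (_ : S →ₐ[R] T), obj S →+* obj T
  map_algebraMap : ∀ {S T : Type u} [CommRing S] [Algebra R S] [CommRing T] [Algebra R T]
    (f : S →ₐ[R] T) (s : S), map f (algebraMap S (obj S) s) = algebraMap T (obj T) (f s)
  map_id : ∀ (S : Type u) [CommRing S] [Algebra R S] (x : obj S),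
    map (AlgHom.id R S) x = x
  map_comp : ∀ {S T U : Type u} [CommRing S] [Algebra R S] [CommRing T] [Algebra R T]
    [CommRing U] [Algebra R U] (f : S →ₐ[R] T) (g : T →ₐ[R] U) (x : obj S),
    map (g.comp f) x = map g (map f x)

namespace AlgebraFunctor

attribute [instance] AlgebraFunctor.ring AlgebraFunctor.algebra

variable {R : Type u} [CommRing R]

/-- The map `A(S) → A(T)`, as a semilinear map. -/
def mapₛₗ (A : AlgebraFunctor.{u, w} R) {S T : Type u} [CommRing S] [Algebra R S] [CommRing T]
    [Algebra R T] (f : S →ₐ[R] T) : A.obj S →ₛₗ[(f : S →+* T)] A.obj T where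
  toFun := A.map f
  map_add' := map_add (A.map f)
  map_smul' s x := by
    rw [Algebra.smul_def, map_mul, A.map_algebraMap, ← Algebra.smul_def]
    rfl

/-- The underlying functor of `𝓡`-modules. -/
def toModuleFunctor (A : AlgebraFunctor.{u, w} R) : ModuleFunctor.{u, w} R where
  obj S _ _ := A.obj S
  map f := A.mapₛₗ f
  map_id S _ _ x := A.map_id S x
  map_comp f g x := A.map_comp f g x

/-- Morphisms of functors of `𝓡`-algebras. -/
@[ext]
structure Hom (A : AlgebraFunctor.{u, w₁} R) (B : AlgebraFunctor.{u, w₂} R) where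
  app : ∀ (S : Type u) [CommRing S] [Algebra R S], A.obj S →ₐ[S] B.obj S
  naturality : ∀ {S T : Type u} [CommRing S] [Algebra R S] [CommRing T] [Algebra R T]
    (f : S →ₐ[R] T) (x : A.obj S), app T (A.map f x) = B.map f (app S x)

/-- Composition of morphisms, `g ∘ f`. -/
def Hom.comp {A : AlgebraFunctor.{u, w₁} R} {B : AlgebraFunctor.{u, w₂} R}
    {C : AlgebraFunctor.{u, w₃} R} (g : Hom B C) (f : Hom A B) : Hom A C where
  app S _ _ := (g.app S).comp (f.app S)
  naturality φ x := by simp [f.naturality, g.naturality]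

/-- The underlying morphism of functors of `𝓡`-modules. -/
def Hom.toModuleHom {A : AlgebraFunctor.{u, w₁} R} {B : AlgebraFunctor.{u, w₂} R}
    (f : Hom A B) : ModuleFunctor.Hom A.toModuleFunctor B.toModuleFunctor where
  app S _ _ := (f.app S).toLinearMap
  naturality φ x := f.naturality φ x

/-- The tensor product of functors of `𝓡`-algebras: `A(S) ⊗_S B(S)` with the multiplication
`(a ⊗ b)(a' ⊗ b') = aa' ⊗ bb'`. -/
def tensor (A : AlgebraFunctor.{u, w₁} R) (B : AlgebraFunctor.{u, w₂} R) :
    AlgebraFunctor.{u, max w₁ w₂} R where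
  obj S _ _ := A.obj S ⊗[S] B.obj S
  map f :=
    { toFun := TensorProduct.map (A.mapₛₗ f) (B.mapₛₗ f)
      map_zero' := map_zero _
      map_add' := map_add _
      map_one' := by
        change A.map f 1 ⊗ₜ B.map f 1 = 1 ⊗ₜ 1
        rw [map_one, map_one]
      map_mul' := fun x y => by
        induction x with
        | zero => rw [zero_mul, map_zero, zero_mul]
        | add x x' hx hx' => rw [add_mul, map_add, hx, hx', map_add, add_mul]
        | tmul a b =>
          induction y with
          | zero => rw [mul_zero, map_zero, mul_zero]
          | add y y' hy hy' => rw [mul_add, map_add, hy, hy', map_add, mul_add]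
          | tmul a' b' =>
            rw [Algebra.TensorProduct.tmul_mul_tmul]
            change A.map f (a * a') ⊗ₜ B.map f (b * b') =
              (A.map f a ⊗ₜ B.map f b) * (A.map f a' ⊗ₜ B.map f b')
            rw [Algebra.TensorProduct.tmul_mul_tmul, map_mul, map_mul] }
  map_algebraMap f s := by
    change A.map f (algebraMap _ _ s) ⊗ₜ B.map f 1 = algebraMap _ _ (f s) ⊗ₜ 1
    rw [map_one, A.map_algebraMap]
  map_id S _ _ x := (A.toModuleFunctor.tensor B.toModuleFunctor).map_id S x
  map_comp f g x := (A.toModuleFunctor.tensor B.toModuleFunctor).map_comp f g x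

/-- The functor of modules underlying `A ⊗ B` is the tensor product of the underlying ones. -/
theorem tensor_toModuleFunctor (A : AlgebraFunctor.{u, w₁} R) (B : AlgebraFunctor.{u, w₂} R) :
    (A.tensor B).toModuleFunctor = A.toModuleFunctor.tensor B.toModuleFunctor := rfl

end AlgebraFunctor

end

noncomputable section

namespace ModuleFunctor

variable {R : Type u} [CommRing R]

/-! ### Isomorphisms of functors of modules and their stability -/

section Isomorphic

variable {M : ModuleFunctor.{u, w} R} {N : ModuleFunctor.{u, w₁} R}
  {M' : ModuleFunctor.{u, w₂} R} {N' : ModuleFunctor.{u, w₃} R}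

/-! Call two subsets of `I` orthogonal when they meet in a finite set. Up to isomorphism, the
essentially free functors are the functors `finOn P` of families `I → S` whose support is orthogonal
to every member of `P`, for an arbitrary set `P` of subsets (`isEssentiallyFree_iff`). Since `finOn
P` depends only on `perp P`, closure under unions can be restored by replacing `P` with `perp (perp
P)`.

The main point is that functionals on `finOn P` are sums of coordinates
(`exists_finset_app_eq_sum`). Evaluate a functional at the generic family `∑ X_i e_i`, `i ∈ β`, over
a polynomial ring. The value is a polynomial, so it involves finitely many variables. Setting the
other variables to zero does not change it, hence by naturality it is a finite linear form, and
every family supported in `β` is a specialization of the generic one. The coefficients therefore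
have support in `perp (perp P)`, which identifies the dual of `finOn P` with `finOn (perp P)`;
reflexivity follows from `perp (perp (perp P)) = perp P`. The same argument describes morphisms
`finOn P → finOn Q` as matrices subject to a finiteness condition of the same kind. Products and
direct sums become `finOn` on a disjoint union of index sets.

For tensor products, currying gives `(M ⊗ N)^* ≃ Hom(M, N^*)`, which is again essentially free. The
universal property of `X → X^{**}` only needs `X^*` to be reflexive. A morphism `X → K^*` is the
same as a morphism `K → X^*`, whose transpose extends it to `X^{**}`. The extension is unique
because pairing with an element of `K` gives an element of `X^{***} = X^*`, determined on `X`
(`HomOver.eq_of_toBidual`).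

For algebras, `A^{**}` carries the product `(θθ')(ξ) = θ(x ↦ θ'(y ↦ ξ(xy)))`. Uniqueness of
extensions, applied to one factor at a time, shows that the linear extension of an algebra morphism
is multiplicative (`app_mul_of_toBidual`). The fixed factor exists only over some `S`, so uniqueness
is needed for functors restricted to `S`-algebras. -/

theorem Hom.ext_app {f g : Hom M N}
    (h : ∀ (S : Type u) [CommRing S] [Algebra R S] (x : M.obj S), f.app S x = g.app S x) :
    f = g :=
  Hom.ext <| funext fun S => funext fun _ => funext fun _ => LinearMap.ext (h S)

/-- The inverse of an isomorphism. -/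
def Hom.inv (f : Hom M N) (hf : f.IsIso) : Hom N M where
  app S _ _ := (LinearEquiv.ofBijective (f.app S) (hf S)).symm
  naturality {S T} _ _ _ _ g x := by
    apply (hf T).1
    rw [f.naturality]
    have h₁ := (LinearEquiv.ofBijective (f.app T) (hf T)).apply_symm_apply (N.map g x)
    have h₂ := (LinearEquiv.ofBijective (f.app S) (hf S)).apply_symm_apply x
    exact h₁.trans (congrArg (N.map g) h₂.symm)

theorem Hom.app_inv_app (f : Hom M N) (hf : f.IsIso) (S : Type u) [CommRing S] [Algebra R S]
    (x : N.obj S) : f.app S ((f.inv hf).app S x) = x :=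
  (LinearEquiv.ofBijective (f.app S) (hf S)).apply_symm_apply x

theorem Hom.inv_app_app (f : Hom M N) (hf : f.IsIso) (S : Type u) [CommRing S] [Algebra R S]
    (x : M.obj S) : (f.inv hf).app S (f.app S x) = x :=
  (LinearEquiv.ofBijective (f.app S) (hf S)).symm_apply_apply x

theorem Hom.IsIso.of_inverse (f : Hom M N) (g : Hom N M)
    (hfg : ∀ (S : Type u) [CommRing S] [Algebra R S] (x : N.obj S), f.app S (g.app S x) = x)
    (hgf : ∀ (S : Type u) [CommRing S] [Algebra R S] (x : M.obj S), g.app S (f.app S x) = x) :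
    f.IsIso := fun S _ _ =>
  Function.bijective_iff_has_inverse.2 ⟨g.app S, hgf S, hfg S⟩

theorem Isomorphic.symm (h : Isomorphic M N) : Isomorphic N M := by
  obtain ⟨f, hf⟩ := h
  exact ⟨f.inv hf, .of_inverse _ f (fun S _ _ x => f.inv_app_app hf S x)
    fun S _ _ x => f.app_inv_app hf S x⟩

theorem Isomorphic.trans (h : Isomorphic M N) (h' : Isomorphic N M') : Isomorphic M M' := by
  obtain ⟨f, hf⟩ := h
  obtain ⟨g, hg⟩ := h'
  exact ⟨g.comp f, fun S _ _ => (hg S).comp (hf S)⟩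

/-- The action of the internal `Hom` on morphisms: `φ ↦ g ∘ φ ∘ f`. -/
def ihomMap (f : Hom M' M) (g : Hom N N') : Hom (ihom M N) (ihom M' N') where
  app S _ _ :=
    { toFun := fun φ =>
        ⟨fun T _ _ h => (g.app T).comp ((HomOver.app φ T h).comp (f.app T)), fun h k x => by
          simp only [LinearMap.comp_apply]
          rw [f.naturality, HomOver.naturality φ, g.naturality]⟩
      map_add' := fun φ ψ => HomOver.ext_app fun T _ _ h => LinearMap.ext fun x =>
        map_add (g.app T) (HomOver.app φ T h (f.app T x)) (HomOver.app ψ T h (f.app T x))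
      map_smul' := fun s φ => HomOver.ext_app fun T _ _ h => LinearMap.ext fun x =>
        map_smul (g.app T) (h s) (HomOver.app φ T h (f.app T x)) }
  naturality _ _ := rfl

theorem Isomorphic.ihom (h : Isomorphic M M') (h' : Isomorphic N N') :
    Isomorphic (M.ihom N) (M'.ihom N') := by
  obtain ⟨f, hf⟩ := h
  obtain ⟨g, hg⟩ := h'
  refine ⟨ihomMap (f.inv hf) g, .of_inverse _ (ihomMap f (g.inv hg)) (fun S _ _ φ => ?_)
    fun S _ _ φ => ?_⟩
  · refine HomOver.ext_app fun T _ _ k => LinearMap.ext fun x => ?_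
    change g.app T ((g.inv hg).app T (HomOver.app φ T k (f.app T ((f.inv hf).app T x)))) = _
    rw [f.app_inv_app, g.app_inv_app]
  · refine HomOver.ext_app fun T _ _ k => LinearMap.ext fun x => ?_
    change (g.inv hg).app T (g.app T (HomOver.app φ T k ((f.inv hf).app T (f.app T x)))) = _
    rw [f.inv_app_app, g.inv_app_app]

/-- The identity morphism. -/
def Hom.id (M : ModuleFunctor.{u, w} R) : Hom M M where
  app _ _ _ := LinearMap.id
  naturality _ _ := rfl

theorem Isomorphic.refl (M : ModuleFunctor.{u, w} R) : Isomorphic M M :=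
  ⟨Hom.id M, fun _ _ _ => Function.bijective_id⟩

theorem Isomorphic.dual (h : Isomorphic M N) : Isomorphic M.dual N.dual :=
  h.ihom (.refl (base R))

/-- The transpose of a morphism. -/
def Hom.transpose (f : Hom M N) : Hom N.dual M.dual := ihomMap f (Hom.id (base R))

theorem Hom.IsIso.transpose {f : Hom M N} (hf : f.IsIso) : f.transpose.IsIso := by
  refine .of_inverse _ (f.inv hf).transpose (fun S _ _ φ => ?_) fun S _ _ φ => ?_
  · refine HomOver.ext_app fun T _ _ k => LinearMap.ext fun x => ?_
    change HomOver.app φ T k ((f.inv hf).app T (f.app T x)) = _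
    rw [f.inv_app_app]
  · refine HomOver.ext_app fun T _ _ k => LinearMap.ext fun x => ?_
    change HomOver.app φ T k (f.app T ((f.inv hf).app T x)) = _
    rw [f.app_inv_app]

theorem toBidual_naturality (f : Hom M N) (S : Type u) [CommRing S] [Algebra R S] (x : M.obj S) :
    N.toBidual.app S (f.app S x) = f.transpose.transpose.app S (M.toBidual.app S x) := by
  refine HomOver.ext_app fun T _ _ k => LinearMap.ext fun φ => ?_
  change HomOver.app φ T (AlgHom.id R T) (N.map k (f.app S x)) =
    HomOver.app φ T (AlgHom.id R T) (f.app T (M.map k x))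
  rw [f.naturality]

/-- In the naturality square of `toBidual`, three sides are isomorphisms, hence so is the fourth. -/
theorem IsReflexive.of_isomorphic (h : Isomorphic M N) (hN : N.IsReflexive) : M.IsReflexive := by
  obtain ⟨f, hf⟩ := h
  intro S _ _
  have h₁ : (f.transpose.transpose.app S ∘ M.toBidual.app S) = (N.toBidual.app S ∘ f.app S) :=
    funext fun x => (toBidual_naturality f S x).symm
  have h₂ := (hN S).comp (hf S)
  rw [← h₁] at h₂
  exact (Function.Bijective.of_comp_iff' (hf.transpose.transpose S) _).1 h₂

theorem Isomorphic.prod {L : Type u} {M : L → ModuleFunctor.{u, w} R}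
    {N : L → ModuleFunctor.{u, w₁} R} (h : ∀ l, Isomorphic (M l) (N l)) :
    Isomorphic (ModuleFunctor.prod M) (ModuleFunctor.prod N) := by
  choose f hf using h
  exact ⟨{
    app := fun S _ _ =>
      { toFun := fun x l => (f l).app S (x l)
        map_add' := fun x y => funext fun l => map_add ((f l).app S) (x l) (y l)
        map_smul' := fun s x => funext fun l => map_smul ((f l).app S) s (x l) }
    naturality := fun k x => funext fun l => (f l).naturality k (x l) },
    fun S _ _ => Function.Bijective.piMap fun l => hf l S⟩

/-- The action of direct sums on morphisms. -/
def directSumMap {L : Type u} {M : L → ModuleFunctor.{u, w} R}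
    {N : L → ModuleFunctor.{u, w₁} R} (f : ∀ l, Hom (M l) (N l)) :
    Hom (directSum M) (directSum N) where
  app S _ _ := DFinsupp.mapRange.linearMap fun l => (f l).app S
  naturality k _ := DFinsupp.ext fun l => (f l).naturality k _

theorem Isomorphic.directSum {L : Type u} {M : L → ModuleFunctor.{u, w} R}
    {N : L → ModuleFunctor.{u, w₁} R} (h : ∀ l, Isomorphic (M l) (N l)) :
    Isomorphic (ModuleFunctor.directSum M) (ModuleFunctor.directSum N) := by
  choose f hf using h
  exact ⟨directSumMap f, .of_inverse _ (directSumMap fun l => (f l).inv (hf l))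
    (fun S _ _ x => DFinsupp.ext fun l => (f l).app_inv_app (hf l) S _)
    fun S _ _ x => DFinsupp.ext fun l => (f l).inv_app_app (hf l) S _⟩

end Isomorphic

/-! ### Orthogonality of sets, the functors `finOn P`, and generic families -/

section FinOn

variable {I : Type u}

/-- The sets that meet every member of `P` in a finite set. -/
def perp (P : Set (Set I)) : Set (Set I) := {β | ∀ α ∈ P, (β ∩ α).Finite}

theorem subset_perp_perp (P : Set (Set I)) : P ⊆ perp (perp P) := fun α hα β hβ => by
  rw [Set.inter_comm]
  exact hβ α hα

theorem perp_anti {P Q : Set (Set I)} (h : P ⊆ Q) : perp Q ⊆ perp P :=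
  fun _ hβ α hα => hβ α (h hα)

/-- `perp` is an order-reversing Galois connection with itself. This identity is the combinatorial
form of reflexivity. -/
theorem perp_perp_perp (P : Set (Set I)) : perp (perp (perp P)) = perp P :=
  (perp_anti (subset_perp_perp P)).antisymm (subset_perp_perp _)

theorem mem_perp_of_finite (P : Set (Set I)) {β : Set I} (hβ : β.Finite) : β ∈ perp P :=
  fun _ _ => hβ.subset Set.inter_subset_left

theorem mem_perp_of_subset {P : Set (Set I)} {β γ : Set I} (hβ : β ∈ perp P) (h : γ ⊆ β) :
    γ ∈ perp P :=
  fun α hα => (hβ α hα).subset (Set.inter_subset_inter_left _ h)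

theorem union_mem_perp {P : Set (Set I)} {β γ : Set I} (hβ : β ∈ perp P) (hγ : γ ∈ perp P) :
    β ∪ γ ∈ perp P := fun α hα => by
  rw [Set.union_inter_distrib_right]
  exact (hβ α hα).union (hγ α hα)

/-- The families `x : I → S` whose restriction to every member of `P` is finitely supported. -/
def finOnSubmodule (P : Set (Set I)) (S : Type u) [CommRing S] : Submodule S (I → S) where
  carrier := {x | Function.support x ∈ perp P}
  add_mem' hx hy := mem_perp_of_subset (union_mem_perp hx hy) (Function.support_add _ _)
  zero_mem' := mem_perp_of_finite P (by simp)
  smul_mem' s x hx := mem_perp_of_subset hx (Function.support_const_smul_subset s x)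

/-- The functor `S ↦ {x : I → S | x is finitely supported on every member of P}`. -/
def finOn (P : Set (Set I)) : ModuleFunctor.{u, u} R where
  obj S _ _ := finOnSubmodule P S
  addCommGroup S _ _ := inferInstanceAs (AddCommGroup (finOnSubmodule P S))
  module S _ _ := inferInstanceAs (Module S (finOnSubmodule P S))
  map f :=
    { toFun := fun x => ⟨fun i => f (x.1 i),
        mem_perp_of_subset x.2 fun i hi hx => hi (by
          change f (x.1 i) = 0
          rw [hx, map_zero])⟩
      map_add' := fun x y => Subtype.ext <| funext fun i => map_add f (x.1 i) (y.1 i)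
      map_smul' := fun s x => Subtype.ext <| funext fun i => map_mul f s (x.1 i) }
  map_id _ _ _ _ := rfl
  map_comp _ _ _ := rfl

namespace finOn

variable (R) in
/-- An element of `finOn P`, from a family with admissible support. -/
def ofFamily {P : Set (Set I)} {S : Type u} [CommRing S] [Algebra R S] (x : I → S)
    (hx : Function.support x ∈ perp P) : (finOn (R := R) P).obj S := ⟨x, hx⟩

/-- The coordinates of an element of `finOn P`. -/
def coord {P : Set (Set I)} {S : Type u} [CommRing S] [Algebra R S]
    (i : I) : (finOn (R := R) P).obj S →ₗ[S] S where
  toFun x := x.1 i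
  map_add' _ _ := rfl
  map_smul' _ _ := rfl

variable {P : Set (Set I)} {S T : Type u} [CommRing S] [Algebra R S] [CommRing T] [Algebra R T]

@[simp] theorem coord_map (f : S →ₐ[R] T) (x : (finOn (R := R) P).obj S) (i : I) :
    coord i ((finOn P).map f x) = f (coord i x) := rfl

theorem ext {x y : (finOn (R := R) P).obj S} (h : ∀ i, coord i x = coord i y) : x = y :=
  Subtype.ext (funext h)

theorem support_mem (x : (finOn (R := R) P).obj S) :
    (Function.support fun i => coord i x) ∈ perp P := x.2

open Classical in
variable (R P S) in
/-- The basis vector `e_i`. -/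
def single (i : I) : (finOn (R := R) P).obj S :=
  ofFamily R (Pi.single i 1) (mem_perp_of_finite P ((Set.finite_singleton i).subset fun j hj => by
    by_contra h
    exact hj (Pi.single_eq_of_ne h _)))

theorem coord_single_same (i : I) : coord i (single R P S i) = 1 := by
  classical exact Pi.single_eq_same i 1

theorem coord_single_of_ne {i j : I} (h : j ≠ i) : coord j (single R P S i) = 0 := by
  classical exact Pi.single_eq_of_ne h _

@[simp] theorem map_single (f : S →ₐ[R] T) (i : I) :
    (finOn P).map f (single R P S i) = single R P T i := by
  refine ext fun j => ?_
  rw [coord_map]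
  by_cases h : j = i
  · subst h
    simp [coord_single_same]
  · simp [coord_single_of_ne h]

open Classical in
variable (R S) in
/-- The element `∑_{i ∈ β} X_i e_i` with coordinates in a polynomial ring. -/
def generic {β : Set I} (hβ : β ∈ perp P) : (finOn (R := R) P).obj (MvPolynomial I S) :=
  ofFamily R (fun i => if i ∈ β then MvPolynomial.X i else 0) (mem_perp_of_subset hβ fun i hi => by
    by_contra h
    exact hi (if_neg h))

theorem coord_generic_of_mem {β : Set I} (hβ : β ∈ perp P) {i : I} (h : i ∈ β) :
    coord i (generic R S hβ) = MvPolynomial.X i := if_pos h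

theorem coord_generic_of_notMem {β : Set I} (hβ : β ∈ perp P) {i : I} (h : i ∉ β) :
    coord i (generic R S hβ) = 0 := if_neg h

/-- Every element supported in `β` is a specialization of the generic one. -/
theorem map_generic {β : Set I} (hβ : β ∈ perp P) (y : (finOn (R := R) P).obj S)
    (hy : ∀ i ∉ β, coord i y = 0) :
    (finOn P).map ((MvPolynomial.aeval (R := S) fun i => coord i y).restrictScalars R)
      (generic R S hβ) = y := by
  refine ext fun i => ?_
  rw [coord_map]
  by_cases h : i ∈ β
  · rw [coord_generic_of_mem hβ h]
    simp
  · rw [coord_generic_of_notMem hβ h, map_zero, hy i h]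

/-- Substitution of values for the variables fixes the constants, so naturality along it leads from
the polynomial ring back to the original structure morphism. -/
theorem aeval_restrictScalars_comp (y : I → S) :
    ((MvPolynomial.aeval (R := S) y).restrictScalars R).comp
      (IsScalarTower.toAlgHom R S (MvPolynomial I S)) = AlgHom.id R S := by
  ext s
  simp

end finOn

open finOn

/-- Naturality of a functional on `S`-algebras `f : S → T`. -/
theorem HomOver.app_eq {M : ModuleFunctor.{u, w} R} {N : ModuleFunctor.{u, w₁} R} {S T : Type u}
    [CommRing S] [Algebra R S] [CommRing T] [Algebra R T] (φ : HomOver M N S) (f : S →ₐ[R] T)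
    (x : M.obj S) : φ.app T f (M.map f x) = N.map f (φ.app S (AlgHom.id R S) x) := by
  rw [← φ.naturality, AlgHom.comp_id]

/-- A functional on `finOn P` is given on families supported in `β` by a finite sum, since its
value at the generic such family is a polynomial, in finitely many variables. -/
theorem exists_finset_app_eq_sum {P : Set (Set I)} {S T : Type u} [CommRing S] [Algebra R S]
    [CommRing T] [Algebra R T] (φ : HomOver (finOn P) (base R) S) (f : S →ₐ[R] T) {β : Set I}
    (hβ : β ∈ perp P) :
    ∃ F : Finset I, ∀ y : (finOn (R := R) P).obj T, (∀ i ∉ β, coord i y = 0) →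
      φ.app T f y = ∑ i ∈ F, f (φ.app S (AlgHom.id R S) (single R P S i)) * coord i y := by
  classical
  let c : T →ₐ[R] MvPolynomial I T := IsScalarTower.toAlgHom R T (MvPolynomial I T)
  let p : MvPolynomial I T := φ.app (MvPolynomial I T) (c.comp f) (generic R T hβ)
  -- `k` kills the variables that do not occur in `p`. It fixes both `p` and the constants, so
  -- naturality along `k` computes `p` from a truncation of the generic family, which is a finite
  -- combination of basis vectors.
  let k : MvPolynomial I T →ₐ[R] MvPolynomial I T := (MvPolynomial.aeval (R := T)
    fun i => if i ∈ p.vars then MvPolynomial.X i else 0).restrictScalars R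
  have hkp : k p = p := by
    have : (MvPolynomial.aeval (R := T)
      fun i => if i ∈ p.vars then MvPolynomial.X i else 0) p = MvPolynomial.aeval (R := T)
        (fun i => (MvPolynomial.X i : MvPolynomial I T)) p :=
      MvPolynomial.eval₂Hom_congr' rfl (fun i hi _ => if_pos hi) rfl
    exact this.trans (MvPolynomial.aeval_X_left_apply p)
  have hkc : k.comp (c.comp f) = c.comp f := by
    ext s
    simp [k, c]
  have hkG : (finOn P).map k (generic R T hβ) =
      ∑ i ∈ p.vars, coord i (generic R T hβ) • single R P (MvPolynomial I T) i := by
    refine finOn.ext fun j => ?_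
    rw [coord_map, map_sum]
    simp only [map_smul, smul_eq_mul]
    by_cases hj : j ∈ p.vars
    · rw [Finset.sum_eq_single j (fun i _ hij => by rw [coord_single_of_ne hij.symm, mul_zero])
        (fun h => absurd hj h), coord_single_same, mul_one]
      by_cases hjβ : j ∈ β
      · simp [coord_generic_of_mem hβ hjβ, k, hj]
      · simp [coord_generic_of_notMem hβ hjβ]
    · rw [Finset.sum_eq_zero fun i hi => by
        rw [coord_single_of_ne (i := i) (j := j) fun h => hj (h ▸ hi), mul_zero]]
      by_cases hjβ : j ∈ β
      · simp [coord_generic_of_mem hβ hjβ, k, hj]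
      · simp [coord_generic_of_notMem hβ hjβ]
  have hp : p = ∑ i ∈ p.vars, coord i (generic R T hβ) *
      c (f (φ.app S (AlgHom.id R S) (single R P S i))) := by
    have h := φ.naturality (c.comp f) k (generic R T hβ)
    rw [hkc, hkG, map_sum] at h
    refine hkp.symm.trans (h.symm.trans (Finset.sum_congr rfl fun i _ => ?_))
    rw [map_smul, ← map_single (c.comp f), φ.app_eq]
    rfl
  refine ⟨p.vars, fun y hy => ?_⟩
  -- Substituting `y_i` for `X_i` carries the generic family to `y` and the formula for `p` to the
  -- desired one; the finite set `p.vars` does not depend on `y`.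
  let ev : MvPolynomial I T →ₐ[R] T :=
    (MvPolynomial.aeval (R := T) fun i => coord i y).restrictScalars R
  have hev : ∀ t, ev (c t) = t := fun t => congrArg (fun g : T →ₐ[R] T => g t)
    (aeval_restrictScalars_comp (R := R) fun i => coord i y)
  have h := φ.naturality (c.comp f) ev (generic R T hβ)
  rw [← AlgHom.comp_assoc, aeval_restrictScalars_comp, AlgHom.id_comp, map_generic hβ y hy] at h
  refine h.trans ?_
  change ev p = _
  refine (congrArg ev hp).trans ?_
  rw [map_sum]
  refine Finset.sum_congr rfl fun i _ => ?_
  rw [map_mul, hev, mul_comm, ← coord_map, map_generic hβ y hy]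

end FinOn

/-! ### The dual of `finOn P` and reflexivity -/

section FinOnDual

open finOn

variable {I : Type u} {P : Set (Set I)}

/-- For `β ∈ perp P`, a single finite set `F` serves all basis vectors `e_i` with `i ∈ β`, and the
sum over `F` vanishes at `e_i` when `i ∉ F`. -/
theorem coeff_support_mem {S : Type u} [CommRing S] [Algebra R S]
    (φ : HomOver (finOn P) (base R) S) :
    (Function.support fun i => (φ.app S (AlgHom.id R S) (single R P S i) : S)) ∈
      perp (perp P) := by
  intro β hβ
  obtain ⟨F, hF⟩ := exists_finset_app_eq_sum φ (AlgHom.id R S) hβ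
  refine F.finite_toSet.subset fun i hi => ?_
  by_contra hiF
  refine hi.1 ((hF (single R P S i) fun j hj => ?_).trans (Finset.sum_eq_zero fun j hj => ?_))
  · exact coord_single_of_ne fun h => hj (h ▸ hi.2)
  · exact mul_eq_zero_of_right (M₀ := S) _
      (coord_single_of_ne (i := i) (j := j) fun h => hiF (h ▸ hj))

/-- The supports of `v` and `y` are in `perp (perp P)` and `perp P`, so they meet in a finite set.
-/
theorem finite_support_mul {S T : Type u} [CommRing S] [Algebra R S] [CommRing T] [Algebra R T]
    (f : S →ₐ[R] T) (v : (finOn (R := R) (perp P)).obj S) (y : (finOn (R := R) P).obj T) :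
    (Function.support fun i => f (coord i v) * coord i y).Finite := by
  refine (support_mem v _ (support_mem y)).subset fun i hi => ⟨fun h => hi ?_, fun h => hi ?_⟩
  · simp only [h, map_zero, zero_mul]
  · simp only [h, mul_zero]

/-- A functional on `finOn P` is the pairing with its values on the basis vectors. -/
theorem app_eq_finsum {S T : Type u} [CommRing S] [Algebra R S] [CommRing T] [Algebra R T]
    (φ : HomOver (finOn P) (base R) S) (f : S →ₐ[R] T) (y : (finOn (R := R) P).obj T) :
    φ.app T f y = ∑ᶠ i, f (φ.app S (AlgHom.id R S) (single R P S i)) * coord i y := by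
  obtain ⟨F, hF⟩ := exists_finset_app_eq_sum φ f (support_mem y)
  rw [hF y fun i hi => by simpa using hi]
  refine (finsum_eq_sum_of_support_subset _ fun i hi => ?_).symm
  by_contra hiF
  refine hi ?_
  -- The vector `y_i e_i` is also supported in the support of `y`. For `i ∉ F` the formula gives it
  -- the value zero, so the `i`-th term of the infinite sum vanishes.
  have h := hF (coord i y • single R P T i) fun j hj => by
    rw [map_smul]
    by_cases hji : j = i
    · subst hji
      have hj : coord j y = 0 := by simpa using hj
      rw [hj, zero_smul]
    · rw [coord_single_of_ne hji, smul_zero]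
  rw [Finset.sum_eq_zero fun j hj => by
    rw [map_smul, coord_single_of_ne (i := i) (j := j) fun h => hiF (h ▸ hj), smul_zero, mul_zero], map_smul,
    ← map_single f, φ.app_eq] at h
  exact (mul_comm (f _) (coord i y)).trans h

variable (R P) in
/-- A functional on `finOn P`, by its values on the basis vectors. -/
def dualCoeff : Hom (finOn P).dual (finOn (R := R) (perp P)) where
  app S _ _ :=
    { toFun := fun φ => ofFamily R (fun i => HomOver.app φ S (AlgHom.id R S) (single R P S i))
        (coeff_support_mem φ)
      map_add' := fun _ _ => rfl
      map_smul' := fun _ _ => rfl }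
  naturality {S T} _ _ _ _ f φ := finOn.ext fun i => by
    change HomOver.app φ T f (single R P T i) = f (HomOver.app φ S (AlgHom.id R S) (single R P S i))
    rw [← map_single f]
    exact HomOver.app_eq φ f _

variable (R P) in
/-- The functional `y ↦ ∑ v_i y_i`. -/
def pairing : Hom (finOn (R := R) (perp P)) (finOn P).dual where
  app S _ _ :=
    { toFun := fun v =>
        ⟨fun T _ _ f =>
          { toFun := fun y => ∑ᶠ i, f (coord i v) * coord i y
            map_add' := fun y z => by
              simp only [map_add, mul_add]
              exact finsum_add_distrib (finite_support_mul f v y) (finite_support_mul f v z)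
            map_smul' := fun t y => by
              refine Eq.trans ?_ (smul_finsum' t (finite_support_mul f v y)).symm
              exact finsum_congr fun i => by
                rw [map_smul, smul_eq_mul, smul_eq_mul]
                exact mul_left_comm (f (coord i v)) t (coord i y) },
        fun {T U} _ _ _ _ f g y => by
          refine Eq.trans ?_ (AddMonoidHom.map_finsum (g : T →+ U) (finite_support_mul f v y)).symm
          exact finsum_congr fun i => (map_mul g _ _).symm⟩
      map_add' := fun v v' => HomOver.ext_app fun T _ _ f => LinearMap.ext fun y => by
        refine Eq.trans ?_
          (finsum_add_distrib (finite_support_mul f v y) (finite_support_mul f v' y))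
        exact finsum_congr fun i => by
          rw [map_add, map_add]
          exact add_mul (f (coord i v)) (f (coord i v')) (coord i y)
      map_smul' := fun s v => HomOver.ext_app fun T _ _ f => LinearMap.ext fun y => by
        refine Eq.trans ?_ (smul_finsum' (f s) (finite_support_mul f v y)).symm
        exact finsum_congr fun i => by
          rw [map_smul, smul_eq_mul, map_mul]
          exact mul_assoc (f s) (f (coord i v)) (coord i y) }
  naturality _ _ := rfl

theorem pairing_app_app {S T : Type u} [CommRing S] [Algebra R S] [CommRing T] [Algebra R T]
    (f : S →ₐ[R] T) (v : (finOn (R := R) (perp P)).obj S) (y : (finOn (R := R) P).obj T) :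
    HomOver.app ((pairing R P).app S v) T f y = ∑ᶠ i, f (coord i v) * coord i y := rfl

theorem pairing_single {S T : Type u} [CommRing S] [Algebra R S] [CommRing T] [Algebra R T]
    (f : S →ₐ[R] T) (v : (finOn (R := R) (perp P)).obj S) (i : I) :
    HomOver.app ((pairing R P).app S v) T f (single R P T i) = f (coord i v) := by
  rw [pairing_app_app, finsum_eq_single _ i fun j hj => by rw [coord_single_of_ne hj, mul_zero],
    coord_single_same, mul_one]

theorem dualCoeff_pairing {S : Type u} [CommRing S] [Algebra R S]
    (v : (finOn (R := R) (perp P)).obj S) : (dualCoeff R P).app S ((pairing R P).app S v) = v :=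
  finOn.ext fun i => pairing_single (AlgHom.id R S) v i

theorem pairing_dualCoeff {S : Type u} [CommRing S] [Algebra R S]
    (φ : (finOn (R := R) P).dual.obj S) : (pairing R P).app S ((dualCoeff R P).app S φ) = φ :=
  HomOver.ext_app fun _ _ _ f => LinearMap.ext fun y => (app_eq_finsum φ f y).symm

variable (P) in
theorem dual_finOn_isomorphic : Isomorphic (finOn (R := R) P).dual (finOn (R := R) (perp P)) :=
  ⟨dualCoeff R P, .of_inverse _ (pairing R P) (fun _ _ _ => dualCoeff_pairing)
    fun _ _ _ => pairing_dualCoeff⟩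

variable (P) in
-- Pairing with the basis vectors of the dual recovers the coordinates, whence injectivity. For
-- surjectivity, transport an element of the bidual along `pairing` to a functional on `finOn (perp
-- P)`: the support of its coefficients is in the triple `perp` of `P`, so they form an element of
-- `finOn P`.
theorem finOn_isReflexive : (finOn (R := R) P).IsReflexive := by
  intro S _ _
  refine ⟨fun m m' h => finOn.ext fun i => ?_, fun θ => ?_⟩
  · have h₁ := congrArg (fun θ : HomOver (finOn P).dual (base R) S =>
      θ.app S (AlgHom.id R S) ((pairing R P).app S (single R (perp P) S i))) h
    have h₂ : ∀ m : (finOn (R := R) P).obj S, HomOver.app ((pairing R P).app S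
        (single R (perp P) S i)) S (AlgHom.id R S) ((finOn P).map (AlgHom.id R S) m) =
        coord i m := fun m => by
      rw [pairing_app_app, finsum_eq_single _ i fun j hj => by
        rw [coord_single_of_ne hj, map_zero, zero_mul], coord_single_same, map_one, one_mul]
      rfl
    exact (h₂ m).symm.trans (h₁.trans (h₂ m'))
  · let θ' : HomOver (finOn (perp P)) (base R) S := (pairing R P).transpose.app S θ
    refine ⟨ofFamily R (fun i => θ'.app S (AlgHom.id R S) (single R (perp P) S i))
      (perp_anti (subset_perp_perp P) (coeff_support_mem θ')), ?_⟩
    refine HomOver.ext_app fun T _ _ f => LinearMap.ext fun φ => ?_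
    rw [← pairing_dualCoeff φ]
    refine Eq.trans ?_ (app_eq_finsum θ' f ((dualCoeff R P).app T φ)).symm
    exact finsum_congr fun i => mul_comm (G := T) _ _

/-- Two families of sets with the same finiteness condition define the same functor. -/
theorem finOn_isomorphic_of_perp_eq {P Q : Set (Set I)} (h : perp P = perp Q) :
    Isomorphic (finOn (R := R) P) (finOn (R := R) Q) :=
  ⟨{ app := fun _ _ _ =>
      { toFun := fun x => ofFamily R (fun i => coord i x) (h ▸ support_mem x)
        map_add' := fun _ _ => rfl
        map_smul' := fun _ _ => rfl }
     naturality := fun _ _ => rfl },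
   fun _ _ _ => ⟨fun _ _ hxy => finOn.ext fun i => congrArg (coord (P := Q) i) hxy,
     fun y => ⟨ofFamily R (fun i => coord i y) (h ▸ support_mem y), rfl⟩⟩⟩

end FinOnDual

/-! ### Morphisms between the functors `finOn` as matrices -/

section FinOnHom

open finOn

variable {I J : Type u} {P : Set (Set I)} {Q : Set (Set J)}

/-- The products `β × α` with `β ∈ P^⊥` and `α ∈ Q`. -/
def homSets (P : Set (Set I)) (Q : Set (Set J)) : Set (Set (I × J)) :=
  {γ | ∃ β ∈ perp P, ∃ α ∈ Q, γ = β ×ˢ α}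

/-- The coordinates of a morphism with values in `finOn Q`. -/
def HomOver.coord {M : ModuleFunctor.{u, w} R} {S : Type u} [CommRing S] [Algebra R S]
    (φ : HomOver M (finOn Q) S) (j : J) : HomOver M (base R) S :=
  ⟨fun T _ _ f => (finOn.coord j).comp (φ.app T f), fun f g x => by
    change finOn.coord j (φ.app _ (g.comp f) (M.map g x)) = g (finOn.coord j (φ.app _ f x))
    rw [φ.naturality, coord_map]⟩

/-- Fix `β` and `α`. All `φ(e_i)` with `i ∈ β` are specializations of the image `g` of one generic
family, so their nonzero coordinates in `α` have indices in one finite set, that of `g`. For each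
such `j`, the `j`-th coordinate of `φ` is a functional, and so has only finitely many nonzero
coefficients in `β`. -/
theorem matrix_support_mem {S : Type u} [CommRing S] [Algebra R S]
    (φ : HomOver (finOn P) (finOn (R := R) Q) S) :
    (Function.support fun ij : I × J =>
      coord ij.2 (φ.app S (AlgHom.id R S) (single R P S ij.1))) ∈ perp (homSets P Q) := by
  rintro _ ⟨β, hβ, α, hα, rfl⟩
  let c : S →ₐ[R] MvPolynomial I S := IsScalarTower.toAlgHom R S (MvPolynomial I S)
  let g := φ.app (MvPolynomial I S) c (generic R S hβ)
  have hg : ((Function.support fun j => coord j g) ∩ α).Finite := support_mem g α hα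
  have key : ∀ i ∈ β, ∀ j, coord j g = 0 →
      coord j (φ.app S (AlgHom.id R S) (single R P S i)) = 0 := fun i hi j hj => by
    have h := φ.naturality c ((MvPolynomial.aeval (R := S)
      fun i' => coord i' (single R P S i)).restrictScalars R) (generic R S hβ)
    rw [aeval_restrictScalars_comp, map_generic hβ _ fun i' hi' =>
      coord_single_of_ne fun h => hi' (h ▸ hi)] at h
    rw [h, coord_map]
    exact (congrArg _ hj).trans (map_zero _)
  refine (hg.biUnion fun j _ => ((coeff_support_mem (φ.coord j) β hβ).image fun i => (i, j))).subset
    ?_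
  rintro ⟨i, j⟩ ⟨hij, hi, hj⟩
  exact Set.mem_biUnion (x := j) ⟨fun h => hij (key i hi j h), hj⟩ ⟨i, ⟨hij, hi⟩, rfl⟩

variable (R P Q) in
/-- The matrix of a morphism. -/
def ihomMatrix : Hom (ihom (finOn P) (finOn Q)) (finOn (R := R) (homSets P Q)) where
  app S _ _ :=
    { toFun := fun φ => ofFamily R
        (fun ij => coord ij.2 (HomOver.app φ S (AlgHom.id R S) (single R P S ij.1)))
        (matrix_support_mem φ)
      map_add' := fun _ _ => rfl
      map_smul' := fun _ _ => rfl }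
  naturality {S T} _ _ _ _ f φ := finOn.ext fun ij => by
    change coord ij.2 (HomOver.app φ T f (single R P T ij.1)) =
      f (coord ij.2 (HomOver.app φ S (AlgHom.id R S) (single R P S ij.1)))
    rw [← map_single f]
    exact congrArg (coord ij.2) (HomOver.app_eq φ f _)

/-- The columns of a matrix. -/
def column (hQ : ∀ j, {j} ∈ Q) {S : Type u} [CommRing S] [Algebra R S]
    (v : (finOn (R := R) (homSets P Q)).obj S) (j : J) : (finOn (R := R) (perp P)).obj S :=
  ofFamily R (fun i => coord (i, j) v) fun β hβ =>
    ((support_mem v _ ⟨β, hβ, {j}, hQ j, rfl⟩).preimage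
      (f := fun i => (i, j)) (Prod.mk_left_injective j).injOn).subset
        fun _ hi => ⟨hi.1, hi.2, rfl⟩

/-- Since singletons belong to `Q`, each column of an admissible matrix is an element of `finOn
(perp P)`, that is, a functional on `finOn P`. A morphism is determined by its coordinate
functionals, and these by their coefficients. -/
theorem ihom_finOn_isomorphic (hQ : ∀ j, {j} ∈ Q) :
    Isomorphic (ihom (finOn (R := R) P) (finOn Q)) (finOn (R := R) (homSets P Q)) := by
  refine ⟨ihomMatrix R P Q, fun S _ _ => ⟨fun φ ψ h => ?_, fun v => ?_⟩⟩
  · refine HomOver.ext_app fun T _ _ f => LinearMap.ext fun y => finOn.ext fun j => ?_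
    have h₁ : HomOver.coord φ j = HomOver.coord ψ j := by
      have : (dualCoeff R P).app S (HomOver.coord φ j) =
          (dualCoeff R P).app S (HomOver.coord ψ j) :=
        finOn.ext fun i => congrArg (coord (i, j)) h
      have h₂ := congrArg ((pairing R P).app S) this
      exact (pairing_dualCoeff _).symm.trans (h₂.trans (pairing_dualCoeff _))
    exact congrArg (fun θ : HomOver (finOn P) (base R) S => θ.app T f y) h₁
  -- The product of the support of `y` with `α` belongs to `homSets P Q`, so it contains finitely
  -- many nonzero entries of `v`. An index `j ∈ α` at which the image of `y` is nonzero is the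
  -- second component of one of them.
  · have hmem : ∀ (T : Type u) [CommRing T] [Algebra R T] (f : S →ₐ[R] T)
        (y : (finOn (R := R) P).obj T), (Function.support fun j =>
          (HomOver.app ((pairing R P).app S (column hQ v j)) T f y : T)) ∈ perp Q := by
      intro T _ _ f y α hα
      refine ((support_mem v _ ⟨_, support_mem y, α, hα, rfl⟩).image Prod.snd).subset ?_
      rintro j ⟨hj, hjα⟩
      by_contra hn
      refine hj ((pairing_app_app f _ y).trans ?_)
      refine finsum_eq_zero_of_forall_eq_zero fun i => ?_
      by_contra hi
      refine hn ⟨(i, j), ⟨fun h => hi ?_, fun h => hi ?_, hjα⟩, rfl⟩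
      · have h : coord i (column hQ v j) = 0 := h
        exact (congrArg (fun t => f t * coord i y) h).trans (by
          rw [map_zero, zero_mul]
          rfl)
      · exact (congrArg (f (coord i (column hQ v j)) * ·) h).trans (mul_zero _)
    refine ⟨⟨fun T _ _ f =>
      { toFun := fun y => ofFamily R _ (hmem T f y)
        map_add' := fun y z => finOn.ext fun j =>
          map_add (HomOver.app ((pairing R P).app S (column hQ v j)) T f) y z
        map_smul' := fun t y => finOn.ext fun j =>
          map_smul (HomOver.app ((pairing R P).app S (column hQ v j)) T f) t y },
      fun f g y => finOn.ext fun j =>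
        HomOver.naturality ((pairing R P).app S (column hQ v j)) f g y⟩, ?_⟩
    exact finOn.ext fun ij => pairing_single (AlgHom.id R S) (column hQ v ij.2) ij.1

end FinOnHom

/-! ### Products and direct sums of the functors `finOn` -/

section FinOnSigma

open finOn

variable {L : Type u} {I : L → Type u}

theorem prod_finOn_isomorphic (P : ∀ l, Set (Set (I l))) :
    Isomorphic (ModuleFunctor.prod fun l => finOn (R := R) (P l))
      (finOn (R := R) {γ : Set (Σ l, I l) | ∃ l, ∃ α ∈ P l, γ = Sigma.mk l '' α}) :=
  ⟨{ app := fun S _ _ =>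
      { toFun := fun x => ofFamily R (fun i => coord i.2 (x i.1)) (by
          rintro _ ⟨l, α, hα, rfl⟩
          refine ((support_mem (x l) α hα).image (Sigma.mk l)).subset ?_
          rintro _ ⟨hi, i, hiα, rfl⟩
          exact ⟨i, ⟨hi, hiα⟩, rfl⟩)
        map_add' := fun _ _ => rfl
        map_smul' := fun _ _ => rfl }
     naturality := fun _ _ => rfl },
   fun S _ _ => ⟨fun x y hxy => funext fun l => finOn.ext fun i => congrArg (coord ⟨l, i⟩) hxy,
     fun y => ⟨fun l => ofFamily R (fun i => coord (⟨l, i⟩ : Σ l, I l) y) fun α hα =>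
       ((support_mem y _ ⟨l, α, hα, rfl⟩).preimage (f := Sigma.mk l)
         sigma_mk_injective.injOn).subset fun i hi => ⟨hi.1, i, hi.2, rfl⟩, rfl⟩⟩⟩

/-- The test sets may have nonempty slices over every `l` at once, and this forces all but finitely
many components of a family to vanish. The assumptions on `P l` make transversals, with at most one
point in each slice, into test sets. -/
theorem directSum_finOn_isomorphic (P : ∀ l, Set (Set (I l))) (h₀ : ∀ l, ∅ ∈ P l)
    (h₁ : ∀ l i, {i} ∈ P l) :
    Isomorphic (directSum fun l => finOn (R := R) (P l))
      (finOn (R := R) {γ : Set (Σ l, I l) | ∀ l, Sigma.mk l ⁻¹' γ ∈ P l}) := by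
  classical
  refine ⟨{
    app := fun S _ _ =>
      { toFun := fun x => ofFamily R (fun i => coord i.2 (DFinsupp.toFun x i.1)) fun γ hγ => ?_
        map_add' := fun _ _ => rfl
        map_smul' := fun _ _ => rfl }
    naturality := fun _ _ => rfl }, fun S _ _ =>
    ⟨fun x y hxy => DFinsupp.ext fun l => finOn.ext fun i => congrArg (coord ⟨l, i⟩) hxy,
      fun y => ?_⟩⟩
  · have hfin : {l | DFinsupp.toFun x l ≠ 0}.Finite := DFinsupp.finite_support x
    refine (hfin.biUnion fun l _ =>
      ((support_mem (DFinsupp.toFun x l) _ (hγ l)).image (Sigma.mk l))).subset ?_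
    rintro ⟨l, i⟩ ⟨hi, hiγ⟩
    exact Set.mem_biUnion (x := l) (fun h => hi (by simp only [h, map_zero])) ⟨i, ⟨hi, hiγ⟩, rfl⟩
  · let z : ∀ l, (finOn (R := R) (P l)).obj S := fun l =>
      ofFamily R (fun i => coord (⟨l, i⟩ : Σ l, I l) y) fun α hα => by
        have hγ : Sigma.mk l '' α ∈ {γ : Set (Σ l, I l) | ∀ l, Sigma.mk l ⁻¹' γ ∈ P l} := by
          intro l'
          by_cases h : l' = l
          · subst h
            rwa [Set.preimage_image_eq _ sigma_mk_injective]
          · rw [Set.preimage_image_sigmaMk_of_ne h]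
            exact h₀ l'
        exact ((support_mem y _ hγ).preimage (f := Sigma.mk l)
          sigma_mk_injective.injOn).subset fun i hi => ⟨hi.1, i, hi.2, rfl⟩
    have hz : {l | z l ≠ 0}.Finite := by
      have hex : ∀ l : {l | z l ≠ 0}, ∃ i : I l.1, coord (⟨l.1, i⟩ : Σ l, I l) y ≠ 0 := by
        rintro ⟨l, hl⟩
        by_contra! h
        exact hl (finOn.ext h)
      choose i hi using hex
      -- One index of a nonzero coordinate is chosen in each nonzero component. The resulting set is
      -- a test set contained in the support of `y`, hence finite.
      have hγ : Set.range (fun l : {l | z l ≠ 0} => (⟨l.1, i l⟩ : Σ l, I l)) ∈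
          {γ : Set (Σ l, I l) | ∀ l, Sigma.mk l ⁻¹' γ ∈ P l} := by
        intro l
        by_cases hl : z l ≠ 0
        · convert h₁ l (i ⟨l, hl⟩)
          ext j
          constructor
          · rintro ⟨⟨l', hl'⟩, h⟩
            obtain rfl : l' = l := congrArg Sigma.fst h
            exact (eq_of_heq (Sigma.mk.inj h).2).symm
          · rintro rfl
            exact ⟨⟨l, hl⟩, rfl⟩
        · convert h₀ l
          refine Set.eq_empty_of_forall_notMem ?_
          rintro j ⟨⟨l', hl'⟩, h⟩
          obtain rfl : l' = l := congrArg Sigma.fst h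
          exact hl hl'
      refine ((support_mem y _ hγ).image Sigma.fst).subset fun l hl => ?_
      exact ⟨⟨l, i ⟨l, hl⟩⟩, ⟨hi ⟨l, hl⟩, ⟨l, hl⟩, rfl⟩, rfl⟩
    refine ⟨DirectSum.mk _ hz.toFinset fun l => z l.1, finOn.ext fun i => ?_⟩
    change coord i.2 (DFinsupp.mk (β := fun l => (finOn (R := R) (P l)).obj S) hz.toFinset
      (fun l => z l.1) i.1) = _
    rw [DFinsupp.mk_apply]
    split_ifs with h
    · rfl
    · have h : z i.1 = 0 := by simpa using h
      rw [map_zero]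
      exact (congrArg (coord i.2) h).symm

end FinOnSigma

/-! ### Essentially free functors as `finOn P`, and their closure properties -/

section EssentiallyFree

open finOn

/-- A compatible system is a single family indexed by the union of `P`, finitely supported on each
member. Indices outside the union carry no coordinate in the limit, so they have to be discarded;
hence the equivalence `e`. -/
theorem finOn_isomorphic_limFree {I J : Type u} (P : Set (Set I))
    (hP : ∀ α ∈ P, ∀ β ∈ P, α ∪ β ∈ P) (e : J ≃ (⋃₀ P : Set I)) :
    Isomorphic (finOn (R := R) {β : Set J | ∃ α ∈ P, β = {j | (e j).1 ∈ α}})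
      (limFree (R := R) P) := by
  refine ⟨{
    app := fun S _ _ =>
      { toFun := fun x => ⟨fun α => Finsupp.ofSupportFinite
          (fun i => coord (e.symm ⟨i.1, α.1, α.2, i.2⟩) x) ?_, fun _ _ _ _ => rfl⟩
        map_add' := fun _ _ => Subtype.ext <| funext fun _ => Finsupp.ext fun _ => rfl
        map_smul' := fun _ _ => Subtype.ext <| funext fun _ => Finsupp.ext fun _ => rfl }
    naturality := fun _ _ => Subtype.ext <| funext fun _ => Finsupp.ext fun _ => rfl },
    fun S _ _ => ⟨fun x y hxy => finOn.ext fun j => ?_, fun y => ?_⟩⟩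
  · refine ((support_mem x _ ⟨α.1, α.2, rfl⟩).preimage
      (f := fun i : α.1 => e.symm ⟨i.1, α.1, α.2, i.2⟩) fun i _ i' _ h => ?_).subset
      fun i hi => ⟨hi, ?_⟩
    · have h' := congrArg Subtype.val (e.symm.injective h)
      exact Subtype.ext h'
    · simp
  · obtain ⟨α, hα, hj⟩ := (e j).2
    have h := DFunLike.congr_fun (congrFun (congrArg Subtype.val hxy) ⟨α, hα⟩) ⟨(e j).1, hj⟩
    change coord (e.symm (e j)) x = coord (e.symm (e j)) y at h
    rwa [e.symm_apply_apply] at h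
  · choose α hα hj using fun j => (e j).2
    -- Closure under unions enters here: both values are compared with the one on `γ ∪ γ'`, so the
    -- choice of a member of `P` containing a given index does not matter.
    have hcompat : ∀ (γ γ' : P) (i : I) (hi : i ∈ γ.1) (hi' : i ∈ γ'.1),
        y.1 γ ⟨i, hi⟩ = y.1 γ' ⟨i, hi'⟩ := fun γ γ' i hi hi' =>
      (y.2 γ ⟨γ.1 ∪ γ'.1, hP _ γ.2 _ γ'.2⟩ Set.subset_union_left ⟨i, hi⟩).trans
        (y.2 γ' ⟨γ.1 ∪ γ'.1, hP _ γ.2 _ γ'.2⟩ Set.subset_union_right ⟨i, hi'⟩).symm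
    refine ⟨ofFamily R (fun j => y.1 ⟨α j, hα j⟩ ⟨(e j).1, hj j⟩) ?_, ?_⟩
    · rintro _ ⟨γ, hγ, rfl⟩
      refine (((y.1 ⟨γ, hγ⟩).hasFiniteSupport.image Subtype.val).preimage
        (f := fun j => (e j).1) (Subtype.val_injective.comp e.injective).injOn).subset ?_
      rintro j ⟨hjs, hjγ⟩
      exact ⟨⟨(e j).1, hjγ⟩, fun h => hjs ((hcompat _ _ _ _ _).trans h), rfl⟩
    · refine Subtype.ext <| funext fun γ => Finsupp.ext fun i => ?_
      change y.1 ⟨α (e.symm _), _⟩ ⟨(e (e.symm _)).1, _⟩ = y.1 γ i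
      simp only [Equiv.apply_symm_apply]
      exact hcompat _ _ _ _ _

/-- For the converse, `perp (perp P)` is closed under unions and defines the same `finOn` as `P`. -/
theorem isEssentiallyFree_iff {M : ModuleFunctor.{u, w} R} :
    M.IsEssentiallyFree ↔
      ∃ (I : Type u) (P : Set (Set I)), Isomorphic M (finOn (R := R) P) := by
  constructor
  · rintro ⟨I, P, hP, h⟩
    exact ⟨_, _, h.trans (finOn_isomorphic_limFree P hP (Equiv.refl _)).symm⟩
  · rintro ⟨I, P, h⟩
    have hU : ∀ α ∈ perp (perp P), ∀ β ∈ perp (perp P), α ∪ β ∈ perp (perp P) :=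
      fun _ hα _ hβ => union_mem_perp hα hβ
    -- Singletons lie in `perp (perp P)`, so its union is all of `I`.
    let e : I ≃ (⋃₀ perp (perp P) : Set I) :=
      { toFun := fun i => ⟨i, {i}, mem_perp_of_finite _ (Set.finite_singleton i), rfl⟩
        invFun := Subtype.val
        left_inv := fun _ => rfl
        right_inv := fun _ => rfl }
    refine ⟨I, perp (perp P), hU, h.trans
      ((finOn_isomorphic_of_perp_eq ?_).trans (finOn_isomorphic_limFree _ hU e))⟩
    have : {β : Set I | ∃ α ∈ perp (perp P), β = {j | (e j).1 ∈ α}} = perp (perp P) := by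
      ext β
      exact ⟨fun ⟨α, hα, h⟩ => h ▸ hα, fun h => ⟨β, h, rfl⟩⟩
    rw [this, perp_perp_perp]

/-- An essentially free functor is of the form `finOn P` with `P` containing all finite sets. -/
theorem IsEssentiallyFree.exists_perp {M : ModuleFunctor.{u, w} R} (h : M.IsEssentiallyFree) :
    ∃ (I : Type u) (P : Set (Set I)), Isomorphic M (finOn (R := R) (perp P)) := by
  obtain ⟨I, P, h⟩ := isEssentiallyFree_iff.1 h
  exact ⟨I, perp P, h.trans (finOn_isomorphic_of_perp_eq (perp_perp_perp P).symm)⟩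

theorem IsEssentiallyFree.of_isomorphic {M : ModuleFunctor.{u, w} R}
    {N : ModuleFunctor.{u, w₁} R} (h : Isomorphic M N) (hN : N.IsEssentiallyFree) :
    M.IsEssentiallyFree := by
  obtain ⟨I, P, hP, h'⟩ := hN
  exact ⟨I, P, hP, h.trans h'⟩

theorem IsEssentiallyFree.isReflexive {M : ModuleFunctor.{u, w} R} (h : M.IsEssentiallyFree) :
    M.IsReflexive := by
  obtain ⟨I, P, h⟩ := isEssentiallyFree_iff.1 h
  exact .of_isomorphic h (finOn_isReflexive P)

theorem IsEssentiallyFree.prod {L : Type u} {M : L → ModuleFunctor.{u, w} R}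
    (h : ∀ l, (M l).IsEssentiallyFree) : (ModuleFunctor.prod M).IsEssentiallyFree := by
  choose I P h using fun l => isEssentiallyFree_iff.1 (h l)
  exact isEssentiallyFree_iff.2 ⟨_, _, (Isomorphic.prod h).trans (prod_finOn_isomorphic P)⟩

theorem IsEssentiallyFree.directSum {L : Type u} {M : L → ModuleFunctor.{u, w} R}
    (h : ∀ l, (M l).IsEssentiallyFree) : (ModuleFunctor.directSum M).IsEssentiallyFree := by
  choose I P h using fun l => (h l).exists_perp
  exact isEssentiallyFree_iff.2 ⟨_, _, (Isomorphic.directSum h).trans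
    (directSum_finOn_isomorphic (fun l => perp (P l))
      (fun _ => mem_perp_of_finite _ Set.finite_empty)
      fun _ i => mem_perp_of_finite _ (Set.finite_singleton i))⟩

theorem IsEssentiallyFree.dual {M : ModuleFunctor.{u, w} R} (h : M.IsEssentiallyFree) :
    M.dual.IsEssentiallyFree := by
  obtain ⟨I, P, h⟩ := isEssentiallyFree_iff.1 h
  exact isEssentiallyFree_iff.2 ⟨_, _, h.dual.trans (dual_finOn_isomorphic P)⟩

theorem IsEssentiallyFree.ihom {M : ModuleFunctor.{u, w} R} {M' : ModuleFunctor.{u, w₁} R}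
    (h : M.IsEssentiallyFree) (h' : M'.IsEssentiallyFree) :
    (M.ihom M').IsEssentiallyFree := by
  obtain ⟨I, P, h⟩ := isEssentiallyFree_iff.1 h
  obtain ⟨I', P', h'⟩ := h'.exists_perp
  exact isEssentiallyFree_iff.2 ⟨_, _, (h.ihom h').trans
    (ihom_finOn_isomorphic fun j => mem_perp_of_finite _ (Set.finite_singleton j))⟩

end EssentiallyFree

/-! ### The dual of a tensor product -/

section Tensor

variable (M : ModuleFunctor.{u, w} R) (N : ModuleFunctor.{u, w₁} R)

/-- Currying `(M ⊗ N)^* → Hom(M, N^*)`. -/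
def tensorDualCurry : Hom (M.tensor N).dual (M.ihom N.dual) where
  app S _ _ :=
    { toFun := fun φ =>
        ⟨fun T _ _ f =>
          { toFun := fun m =>
              ⟨fun U _ _ g =>
                { toFun := fun n => HomOver.app φ U (g.comp f) (M.map g m ⊗ₜ[U] n)
                  map_add' := fun n n' => by
                    rw [TensorProduct.tmul_add]
                    exact map_add (HomOver.app φ U (g.comp f)) _ _
                  map_smul' := fun t n => by
                    rw [TensorProduct.tmul_smul]
                    exact map_smul (HomOver.app φ U (g.comp f)) t _ },
              fun {U V} _ _ _ _ g k n => by
                have h := HomOver.naturality φ (g.comp f) k (M.map g m ⊗ₜ[U] n)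
                refine Eq.trans ?_ h
                change HomOver.app φ V _ (M.map (k.comp g) m ⊗ₜ[V] N.map k n) =
                  HomOver.app φ V _ (M.map k (M.map g m) ⊗ₜ[V] N.map k n)
                rw [M.map_comp]
                rfl⟩
            map_add' := fun m m' => HomOver.ext_app fun U _ _ g => LinearMap.ext fun n => by
              change HomOver.app φ U (g.comp f) (M.map g (m + m') ⊗ₜ[U] n) = _
              rw [map_add, TensorProduct.add_tmul]
              exact map_add (HomOver.app φ U (g.comp f)) _ _
            map_smul' := fun t m => HomOver.ext_app fun U _ _ g => LinearMap.ext fun n => by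
              change HomOver.app φ U (g.comp f) (M.map g (t • m) ⊗ₜ[U] n) = _
              rw [map_smulₛₗ, ← TensorProduct.smul_tmul']
              exact map_smul (HomOver.app φ U (g.comp f)) (g t) _ },
        fun {T U} _ _ _ _ f g m => HomOver.ext_app fun V _ _ k => LinearMap.ext fun n => by
          change HomOver.app φ V (k.comp (g.comp f)) (M.map k (M.map g m) ⊗ₜ[V] n) =
            HomOver.app φ V ((k.comp g).comp f) (M.map (k.comp g) m ⊗ₜ[V] n)
          rw [M.map_comp]
          rfl⟩
      map_add' := fun _ _ => rfl
      map_smul' := fun _ _ => rfl }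
  naturality _ _ := rfl

variable {M N} in
/-- The linear map `m ⊗ n ↦ ψ(m)(n)`. -/
def HomOver.uncurry {S T : Type u} [CommRing S] [Algebra R S] [CommRing T] [Algebra R T]
    (ψ : HomOver M N.dual S) (f : S →ₐ[R] T) : M.obj T ⊗[T] N.obj T →ₗ[T] (base R).obj T :=
  TensorProduct.lift (LinearMap.mk₂ T
    (fun m n => HomOver.app (ψ.app T f m : HomOver N (base R) T) T (AlgHom.id R T) n)
    (fun m m' n => by
      rw [map_add]
      rfl)
    (fun t m n => by
      rw [map_smul]
      rfl)
    (fun m n n' => map_add _ n n')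
    (fun t m n => map_smul _ t n))

variable {M N} in
theorem HomOver.uncurry_map {S T U : Type u} [CommRing S] [Algebra R S] [CommRing T]
    [Algebra R T] [CommRing U] [Algebra R U] (ψ : HomOver M N.dual S) (f : S →ₐ[R] T)
    (g : T →ₐ[R] U) (x : M.obj T ⊗[T] N.obj T) :
    ψ.uncurry (g.comp f) (TensorProduct.map (M.map g) (N.map g) x) =
      (base R).map g (ψ.uncurry f x) := by
  induction x with
  | zero => simp only [map_zero]
  | add x y hx hy => simp only [map_add, hx, hy]
  | tmul m n =>
    change HomOver.app (ψ.app U (g.comp f) (M.map g m) : HomOver N (base R) U) U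
      (AlgHom.id R U) (N.map g n) = _
    rw [ψ.naturality]
    exact HomOver.naturality (ψ.app T f m : HomOver N (base R) T) (AlgHom.id R T) g n

/-- This is the tensor-hom adjunction. The inverse evaluates the inner functional only at the
identity of `T`; naturality in the outer variable recovers its values on all `T`-algebras. -/
theorem tensorDualCurry_isIso : (tensorDualCurry M N).IsIso := by
  intro S _ _
  constructor
  · intro φ ψ h
    refine HomOver.ext_app fun T _ _ f => TensorProduct.ext' fun m n => ?_
    have h₁ := congrArg (fun θ : HomOver M N.dual S =>
      HomOver.app (θ.app T f m : HomOver N (base R) T) T (AlgHom.id R T) n) h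
    change HomOver.app φ T ((AlgHom.id R T).comp f) (M.map (AlgHom.id R T) m ⊗ₜ[T] n) =
      HomOver.app ψ T ((AlgHom.id R T).comp f) (M.map (AlgHom.id R T) m ⊗ₜ[T] n) at h₁
    rwa [M.map_id] at h₁
  · intro ψ
    refine ⟨⟨fun T _ _ f => HomOver.uncurry ψ f, fun f g x => HomOver.uncurry_map ψ f g x⟩, ?_⟩
    refine HomOver.ext_app fun T _ _ f => LinearMap.ext fun m =>
      HomOver.ext_app fun U _ _ g => LinearMap.ext fun n => ?_
    change HomOver.app (HomOver.app ψ U (g.comp f) (M.map g m) : HomOver N (base R) U) U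
      (AlgHom.id R U) n = _
    have h := HomOver.naturality ψ f g m
    rw [h]
    rfl

variable {M N} in
theorem IsEssentiallyFree.tensor_dual (h : M.IsEssentiallyFree) (h' : N.IsEssentiallyFree) :
    (M.tensor N).dual.IsEssentiallyFree :=
  .of_isomorphic ⟨_, tensorDualCurry_isIso M N⟩ (h.ihom h'.dual)

end Tensor

/-! ### The universal property of `X → X^{**}` for dual targets -/

section Bidual

variable {X : ModuleFunctor.{u, w} R} {N : ModuleFunctor.{u, w₁} R} {K : ModuleFunctor.{u, w₂} R}

/-- The functional `y ↦ φ(y)(n)`. -/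
def HomOver.evalAt {S : Type u} [CommRing S] [Algebra R S] (φ : HomOver X K.dual S)
    (n : K.obj S) : X.dual.obj S :=
  ⟨fun T _ _ f =>
    { toFun := fun y =>
        HomOver.app (φ.app T f y : HomOver K (base R) T) T (AlgHom.id R T) (K.map f n)
      map_add' := fun y z => by
        rw [map_add]
        rfl
      map_smul' := fun t y => by
        rw [map_smul]
        rfl },
  fun {T U} _ _ _ _ f g y => by
    refine Eq.trans ?_ (HomOver.naturality (φ.app T f y : HomOver K (base R) T)
      (AlgHom.id R T) g (K.map f n))
    have h := φ.naturality f g y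
    change HomOver.app (φ.app U (g.comp f) (X.map g y) : HomOver K (base R) U) U _
      (K.map (g.comp f) n) = _
    rw [h, K.map_comp]
    rfl⟩

/-- The morphism of restrictions defined by a morphism. -/
def Hom.over (ψ : Hom X N) (S : Type u) [CommRing S] [Algebra R S] : HomOver X N S :=
  ⟨fun T _ _ _ => ψ.app T, fun _ g x => ψ.naturality g x⟩

/-- The morphism `K → X^*` corresponding to a morphism `X → K^*`. -/
def Hom.swap (ψ : Hom X K.dual) : Hom K X.dual where
  app S _ _ :=
    { toFun := fun n => (ψ.over S).evalAt n
      map_add' := fun n n' => HomOver.ext_app fun T _ _ f => LinearMap.ext fun y => by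
        change HomOver.app (ψ.app T y : HomOver K (base R) T) T _ (K.map f (n + n')) = _
        rw [map_add, map_add]
        rfl
      map_smul' := fun s n => HomOver.ext_app fun T _ _ f => LinearMap.ext fun y => by
        change HomOver.app (ψ.app T y : HomOver K (base R) T) T _ (K.map f (s • n)) = _
        rw [map_smulₛₗ, map_smul]
        rfl }
  naturality {S T} _ _ _ _ f n := HomOver.ext_app fun U _ _ g => LinearMap.ext fun y => by
    change HomOver.app (ψ.app U y : HomOver K (base R) U) U _ (K.map g (K.map f n)) =
      HomOver.app (ψ.app U y : HomOver K (base R) U) U _ (K.map (g.comp f) n)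
    rw [K.map_comp]

/-- This is the existence half of the universal property: the transpose of `K → X^*` extends `ψ` to
`X^{**}`. -/
theorem Hom.swap_transpose_toBidual (ψ : Hom X K.dual) (S : Type u) [CommRing S] [Algebra R S]
    (x : X.obj S) : ψ.swap.transpose.app S (X.toBidual.app S x) = ψ.app S x := by
  refine HomOver.ext_app fun T _ _ f => LinearMap.ext fun n => ?_
  change HomOver.app (ψ.app T (X.map f x) : HomOver K (base R) T) T
    (AlgHom.id R T) (K.map (AlgHom.id R T) n) = _
  rw [K.map_id, ψ.naturality]
  rfl

/-- A morphism from `X^{**}` to a dual functor is determined by its restriction to `X`. -/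
theorem HomOver.eq_of_toBidual (hX : X.dual.IsReflexive) (hN : IsDual.{u, w₁, w₂} N)
    {S : Type u} [CommRing S] [Algebra R S] {φ ψ : HomOver X.dual.dual N S}
    (h : ∀ (T : Type u) [CommRing T] [Algebra R T] (f : S →ₐ[R] T) (x : X.obj T),
      φ.app T f (X.toBidual.app T x) = ψ.app T f (X.toBidual.app T x)) : φ = ψ := by
  obtain ⟨K, e, he⟩ := hN
  -- After pairing with `n`, both morphisms become elements of `X^{***}(T)`, which reflexivity of
  -- `X^*` presents as images of `ξ, η ∈ X^*(T)`.
  have key : ∀ (T : Type u) [CommRing T] [Algebra R T] (f : S →ₐ[R] T) (n : K.obj T),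
      HomOver.evalAt ((ihom _ _).map f ((ihomMap (Hom.id _) e).app S φ)) n =
        HomOver.evalAt ((ihom _ _).map f ((ihomMap (Hom.id _) e).app S ψ)) n := by
    intro T _ _ f n
    obtain ⟨ξ, hξ⟩ := (hX T).2
      (HomOver.evalAt ((ihom _ _).map f ((ihomMap (Hom.id _) e).app S φ)) n)
    obtain ⟨η, hη⟩ := (hX T).2
      (HomOver.evalAt ((ihom _ _).map f ((ihomMap (Hom.id _) e).app S ψ)) n)
    have hval : ∀ (ζ : X.dual.obj T) (U : Type u) [CommRing U] [Algebra R U] (g : T →ₐ[R] U)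
        (x : X.obj U), HomOver.app (X.dual.toBidual.app T ζ) U g (X.toBidual.app U x) =
          HomOver.app ζ U g x := by
      intro ζ U _ _ g x
      change HomOver.app ζ U ((AlgHom.id R U).comp g) (X.map (AlgHom.id R U) x) = _
      rw [X.map_id]
      rfl
    -- The image of `ξ` in `X^{***}`, evaluated at the image of `x` in `X^{**}`, gives back `ξ(x)`;
    -- so agreement on `X` suffices.
    have : ξ = η := HomOver.ext_app fun U _ _ g => LinearMap.ext fun x => by
      refine (hval ξ U g x).symm.trans (Eq.trans ?_ (hval η U g x))
      rw [hξ, hη]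
      exact congrArg (fun z => HomOver.app (e.app U z : HomOver K (base R) U) U (AlgHom.id R U)
        (K.map g n)) (h U (g.comp f) x)
    rw [← hξ, ← hη, this]
  refine HomOver.ext_app fun T _ _ f => LinearMap.ext fun θ => (he T).1 ?_
  refine HomOver.ext_app fun U _ _ g => LinearMap.ext fun n => ?_
  have hval : ∀ χ : HomOver X.dual.dual N S,
      HomOver.app (HomOver.evalAt ((ihom _ _).map (g.comp f) ((ihomMap (Hom.id _) e).app S χ)) n)
        U (AlgHom.id R U) (X.dual.dual.map g θ) =
      HomOver.app (e.app T (χ.app T f θ) : HomOver K (base R) T) U g n := by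
    intro χ
    change HomOver.app (e.app U (χ.app U (g.comp f) (X.dual.dual.map g θ)) :
      HomOver K (base R) U) U (AlgHom.id R U) (K.map (AlgHom.id R U) n) = _
    rw [χ.naturality, e.naturality, K.map_id]
    rfl
  refine (hval φ).symm.trans (Eq.trans ?_ (hval ψ))
  rw [key]

theorem comp_toBidual_bijective (hX : X.dual.IsReflexive) (hN : IsDual.{u, w₁, w₂} N) :
    Function.Bijective fun φ : Hom X.dual.dual N => φ.comp X.toBidual := by
  constructor
  · intro φ ψ h
    refine Hom.ext_app fun S _ _ θ => ?_
    have h₁ : φ.over S = ψ.over S := HomOver.eq_of_toBidual hX hN fun T _ _ _ x =>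
      congrArg (fun χ : Hom X N => χ.app T x) h
    exact congrArg (fun χ : HomOver X.dual.dual N S => χ.app S (AlgHom.id R S) θ) h₁
  · intro ψ
    obtain ⟨K, e, he⟩ := hN
    refine ⟨(e.inv he).comp (e.comp ψ).swap.transpose, Hom.ext_app fun S _ _ x => ?_⟩
    change (e.inv he).app S ((e.comp ψ).swap.transpose.app S (X.toBidual.app S x)) = _
    rw [Hom.swap_transpose_toBidual]
    exact e.inv_app_app he S _

end Bidual

end ModuleFunctor

namespace AlgebraFunctor

variable {R : Type u} [CommRing R]

/-! ### The algebra structure on `A^{**}` -/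

section Bidual

open ModuleFunctor

variable (A : AlgebraFunctor.{u, w} R) {S T : Type u} [CommRing S] [Algebra R S] [CommRing T]
  [Algebra R T]

/-- Functionals on `A_{|S}`. -/
abbrev Functional (S : Type u) [CommRing S] [Algebra R S] : Type (max (u + 1) w) :=
  HomOver A.toModuleFunctor (base R) S

/-- Elements of `A^{**}(S)`. -/
abbrev BidualObj (S : Type u) [CommRing S] [Algebra R S] : Type (max (u + 1) w) :=
  HomOver A.toModuleFunctor.dual (base R) S

variable {A}

/-- The value of a functional on `A_{|S}` at an element of `A(T)`. -/
abbrev Functional.val (ξ : A.Functional S) (f : S →ₐ[R] T) (x : A.obj T) : T := ξ.app T f x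

theorem Functional.val_add (ξ : A.Functional S) (f : S →ₐ[R] T) (x y : A.obj T) :
    ξ.val f (x + y) = ξ.val f x + ξ.val f y := map_add (ξ.app T f) x y

theorem Functional.val_smul (ξ : A.Functional S) (f : S →ₐ[R] T) (t : T) (x : A.obj T) :
    ξ.val f (t • x) = t * ξ.val f x := map_smul (ξ.app T f) t x

theorem Functional.ext_val {ξ η : A.Functional S}
    (h : ∀ (T : Type u) [CommRing T] [Algebra R T] (f : S →ₐ[R] T) (x : A.obj T),
      ξ.val f x = η.val f x) : ξ = η :=
  HomOver.ext_app fun T _ _ f => LinearMap.ext fun x => h T f x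

/-- The restriction of a functional to `T`-algebras. -/
abbrev Functional.restrict (ξ : A.Functional S) (f : S →ₐ[R] T) : A.Functional T :=
  A.toModuleFunctor.dual.map f ξ

/-- The functional `y ↦ ξ(xy)`. -/
def Functional.mulArg (ξ : A.Functional S) (x : A.obj S) : A.Functional S :=
  ⟨fun T _ _ f => (ξ.app T f).comp (LinearMap.mulLeft T (A.map f x)),
  fun {T U} _ _ _ _ f g (y : A.obj T) => by
    refine Eq.trans ?_ (ξ.naturality f g (A.map f x * y : A.obj T))
    change ξ.val (g.comp f) (A.map (g.comp f) x * A.map g y) =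
      ξ.val (g.comp f) (A.map g (A.map f x * y))
    rw [map_mul, A.map_comp]⟩

theorem Functional.mulArg_val (ξ : A.Functional S) (x : A.obj S) (f : S →ₐ[R] T) (y : A.obj T) :
    (ξ.mulArg x).val f y = ξ.val f (A.map f x * y) := rfl

theorem Functional.restrict_val {U : Type u} [CommRing U] [Algebra R U] (ξ : A.Functional S)
    (f : S →ₐ[R] T) (g : T →ₐ[R] U) (y : A.obj U) :
    (ξ.restrict f).val g y = ξ.val (g.comp f) y := rfl

theorem Functional.mulArg_restrict (ξ : A.Functional S) (x : A.obj S) (f : S →ₐ[R] T) :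
    (ξ.mulArg x).restrict f = (ξ.restrict f).mulArg (A.map f x) :=
  ext_val fun U _ _ g y => by
    rw [restrict_val, mulArg_val, mulArg_val, restrict_val, A.map_comp]

theorem Functional.mulArg_add (ξ : A.Functional S) (x y : A.obj S) :
    ξ.mulArg (x + y) = ξ.mulArg x + ξ.mulArg y :=
  ext_val fun U _ _ g z => by
    rw [mulArg_val, map_add, add_mul, val_add]
    rfl

theorem Functional.mulArg_smul (ξ : A.Functional S) (s : S) (x : A.obj S) :
    ξ.mulArg (s • x) = s • ξ.mulArg x :=
  ext_val fun U _ _ g z => by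
    have h : A.map g (s • x) = g s • A.map g x := map_smulₛₗ (A.mapₛₗ g) s x
    rw [mulArg_val, h, smul_mul_assoc, val_smul]
    rfl

theorem Functional.mulArg_mulArg (ξ : A.Functional S) (x y : A.obj S) :
    (ξ.mulArg x).mulArg y = ξ.mulArg (x * y) :=
  ext_val fun U _ _ g z => by
    rw [mulArg_val, mulArg_val, mulArg_val, map_mul, mul_assoc]

/-- The restriction of an element of `A^{**}(S)` to `T`-algebras. -/
abbrev BidualObj.restrict (θ : A.BidualObj S) (f : S →ₐ[R] T) : A.BidualObj T :=
  A.toModuleFunctor.dual.dual.map f θ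

/-- The value of `θ ∈ A^{**}(S)` at a functional on `A_{|T}`. -/
abbrev BidualObj.val (θ : A.BidualObj S) (f : S →ₐ[R] T) (ξ : A.Functional T) : T :=
  θ.app T f ξ

theorem BidualObj.val_add (θ : A.BidualObj S) (f : S →ₐ[R] T) (ξ η : A.Functional T) :
    θ.val f (ξ + η) = θ.val f ξ + θ.val f η := map_add (θ.app T f) ξ η

theorem BidualObj.val_smul (θ : A.BidualObj S) (f : S →ₐ[R] T) (t : T) (ξ : A.Functional T) :
    θ.val f (t • ξ) = t * θ.val f ξ := map_smul (θ.app T f) t ξ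

theorem BidualObj.ext_val {θ θ' : A.BidualObj S}
    (h : ∀ (T : Type u) [CommRing T] [Algebra R T] (f : S →ₐ[R] T) (ξ : A.Functional T),
      θ.val f ξ = θ'.val f ξ) : θ = θ' :=
  HomOver.ext_app fun T _ _ f => LinearMap.ext fun ξ => h T f ξ

/-- The functional `x ↦ θ(y ↦ ξ(xy))`. -/
def BidualObj.act (θ : A.BidualObj S) (ξ : A.Functional S) : A.Functional S :=
  ⟨fun T _ _ f =>
    { toFun := fun x => θ.val (T := T) f ((ξ.restrict f).mulArg x)
      map_add' := fun x y =>
        (congrArg (θ.val f) ((ξ.restrict f).mulArg_add x y)).trans (θ.val_add f _ _)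
      map_smul' := fun t x =>
        (congrArg (θ.val f) ((ξ.restrict f).mulArg_smul t x)).trans (θ.val_smul f t _) },
  fun {T U} _ _ _ _ f g x => by
    refine Eq.trans ?_ (θ.naturality f g ((ξ.restrict f).mulArg x))
    exact congrArg (θ.val (g.comp f)) ((ξ.restrict f).mulArg_restrict x g).symm⟩

theorem BidualObj.act_val (θ : A.BidualObj S) (ξ : A.Functional S) (f : S →ₐ[R] T)
    (x : A.obj T) : (θ.act ξ).val f x = θ.val f ((ξ.restrict f).mulArg x) := rfl

theorem BidualObj.act_add (θ : A.BidualObj S) (ξ η : A.Functional S) :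
    θ.act (ξ + η) = θ.act ξ + θ.act η :=
  Functional.ext_val fun _ _ _ f x =>
    θ.val_add f ((ξ.restrict f).mulArg x) ((η.restrict f).mulArg x)

theorem BidualObj.act_smul (θ : A.BidualObj S) (s : S) (ξ : A.Functional S) :
    θ.act (s • ξ) = s • θ.act ξ :=
  Functional.ext_val fun _ _ _ f x => θ.val_smul f (f s) ((ξ.restrict f).mulArg x)

/-- The product `(θθ')(ξ) = θ(x ↦ θ'(y ↦ ξ(xy)))` on `A^{**}`. -/
instance : Mul (A.BidualObj S) where
  mul θ θ' := ⟨fun T _ _ f =>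
    { toFun := fun ξ => θ.val (T := T) f ((θ'.restrict f).act ξ)
      map_add' := fun ξ η =>
        (congrArg (θ.val f) ((θ'.restrict f).act_add ξ η)).trans (θ.val_add f _ _)
      map_smul' := fun t ξ =>
        (congrArg (θ.val f) ((θ'.restrict f).act_smul t ξ)).trans (θ.val_smul f t _) },
    fun f g ξ => θ.naturality f g ((θ'.restrict f).act ξ)⟩

theorem BidualObj.mul_val (θ θ' : A.BidualObj S) (f : S →ₐ[R] T) (ξ : A.Functional T) :
    (θ * θ').val f ξ = θ.val f ((θ'.restrict f).act ξ) := rfl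

/-- The image of `x ∈ A(S)` in `A^{**}(S)`. -/
abbrev toBidualObj (x : A.obj S) : A.BidualObj S := A.toModuleFunctor.toBidual.app S x

theorem toBidualObj_restrict (x : A.obj S) (f : S →ₐ[R] T) :
    (toBidualObj x).restrict f = toBidualObj (A.map f x) :=
  (A.toModuleFunctor.toBidual.naturality f x).symm

theorem toBidualObj_val (x : A.obj S) (f : S →ₐ[R] T) (ξ : A.Functional T) :
    (toBidualObj x).val f ξ = ξ.val (AlgHom.id R T) (A.map f x) := rfl

theorem toBidualObj_act_val (x : A.obj S) (ξ : A.Functional S) (f : S →ₐ[R] T) (y : A.obj T) :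
    ((toBidualObj x).act ξ).val f y = ξ.val f (y * A.map f x) := by
  rw [BidualObj.act_val, toBidualObj_val, Functional.mulArg_val, Functional.restrict_val, A.map_id]
  rfl

theorem toBidualObj_mul (x y : A.obj S) :
    toBidualObj (x * y) = toBidualObj x * toBidualObj y :=
  BidualObj.ext_val fun T _ _ f ξ => by
    rw [BidualObj.mul_val, toBidualObj_restrict, toBidualObj_val, toBidualObj_val,
      toBidualObj_act_val, map_mul, A.map_id]

instance : One (A.BidualObj S) where
  one := toBidualObj 1

theorem BidualObj.one_def : (1 : A.BidualObj S) = toBidualObj 1 := rfl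

/-- Associativity of `A` makes `act` compatible with products. As `θθ'` is `θ` composed with the
action of `θ'`, this yields associativity of `A^{**}`. -/
theorem BidualObj.mul_act (θ θ' : A.BidualObj S) (ξ : A.Functional S) :
    (θ * θ').act ξ = θ.act (θ'.act ξ) := by
  refine Functional.ext_val fun T _ _ f x => congrArg (θ.val f) ?_
  refine Functional.ext_val fun U _ _ g y => congrArg (θ'.val (g.comp f)) ?_
  exact (congrArg (Functional.mulArg · y) ((ξ.restrict f).mulArg_restrict x g)).trans
    (Functional.mulArg_mulArg _ _ _)

instance : Ring (A.BidualObj S) :=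
  { (inferInstance : AddCommGroup (A.BidualObj S)),
    (inferInstance : Mul (A.BidualObj S)),
    (inferInstance : One (A.BidualObj S)) with
    left_distrib := fun θ θ₁ θ₂ => BidualObj.ext_val fun _ _ _ f ξ =>
      θ.val_add f ((θ₁.restrict f).act ξ) ((θ₂.restrict f).act ξ)
    right_distrib := fun _ _ _ => rfl
    zero_mul := fun _ => rfl
    mul_zero := fun θ => BidualObj.ext_val fun T _ _ f _ => map_zero (θ.app T f)
    mul_assoc := fun θ θ₁ θ₂ => BidualObj.ext_val fun _ _ _ f ξ =>
      congrArg (θ.val f) ((θ₁.restrict f).mul_act (θ₂.restrict f) ξ).symm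
    one_mul := fun θ => BidualObj.ext_val fun T _ _ f ξ => by
      rw [BidualObj.mul_val, BidualObj.one_def, toBidualObj_val, BidualObj.act_val]
      refine congrArg (θ.val f) (Functional.ext_val fun U _ _ g y => ?_)
      rw [Functional.mulArg_val, map_one, map_one, one_mul]
      rfl
    mul_one := fun θ => BidualObj.ext_val fun T _ _ f ξ => by
      rw [BidualObj.mul_val, BidualObj.one_def, toBidualObj_restrict]
      refine congrArg (θ.val f) (Functional.ext_val fun U _ _ g y => ?_)
      rw [toBidualObj_act_val, map_one, map_one, mul_one] }

instance : Algebra S (A.BidualObj S) :=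
  Algebra.ofModule (fun _ _ _ => rfl) fun s θ θ' => BidualObj.ext_val fun _ _ _ f ξ =>
    θ.val_smul f (f s) ((θ'.restrict f).act ξ)

variable (A) in
/-- The functor of algebras `A^{**}`. -/
def bidual : AlgebraFunctor.{u, max (u + 1) w} R where
  obj S _ _ := A.BidualObj S
  map f :=
    { toFun := fun θ => θ.restrict f
      map_zero' := rfl
      map_add' := fun _ _ => rfl
      map_one' := (toBidualObj_restrict 1 f).trans (congrArg toBidualObj (map_one (A.map f)))
      map_mul' := fun _ _ => rfl }
  map_algebraMap {S T} _ _ _ _ f s := by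
    change f s • (toBidualObj (1 : A.obj S)).restrict f = f s • toBidualObj (1 : A.obj T)
    rw [toBidualObj_restrict, map_one]
  map_id _ _ _ _ := rfl
  map_comp _ _ _ := rfl

variable (A) in
/-- The natural morphism `A → A^{**}`, as a morphism of functors of algebras. -/
def toBidual : Hom A A.bidual where
  app S _ _ := AlgHom.ofLinearMap (A.toModuleFunctor.toBidual.app S) rfl toBidualObj_mul
  naturality f x := A.toModuleFunctor.toBidual.naturality f x

end Bidual

/-! ### The universal property of `A → A^{**}` for algebras -/

section Universal

variable {A : AlgebraFunctor.{u, w} R} {B : AlgebraFunctor.{u, w₁} R}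

/-- Right multiplication by `b`. -/
def mulRightOver (B : AlgebraFunctor.{u, w} R) {S : Type u} [CommRing S] [Algebra R S]
    (b : B.obj S) : ModuleFunctor.HomOver B.toModuleFunctor B.toModuleFunctor S :=
  ⟨fun T _ _ f => LinearMap.mulRight T (B.map f b), fun {T U} _ _ _ _ f g (x : B.obj T) => by
    change B.map g x * B.map (g.comp f) b = B.map g (x * B.map f b)
    rw [map_mul, B.map_comp]⟩

/-- Left multiplication by `b`. -/
def mulLeftOver (B : AlgebraFunctor.{u, w} R) {S : Type u} [CommRing S] [Algebra R S]
    (b : B.obj S) : ModuleFunctor.HomOver B.toModuleFunctor B.toModuleFunctor S :=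
  ⟨fun T _ _ f => LinearMap.mulLeft T (B.map f b), fun {T U} _ _ _ _ f g (x : B.obj T) => by
    change B.map (g.comp f) b * B.map g x = B.map g (B.map f b * x)
    rw [map_mul, B.map_comp]⟩

/-- The components of a morphism between the underlying functors of modules. -/
abbrev appₗ (φ : ModuleFunctor.Hom A.toModuleFunctor B.toModuleFunctor) (S : Type u) [CommRing S]
    [Algebra R S] : A.obj S →ₗ[S] B.obj S := φ.app S

theorem appₗ_map (φ : ModuleFunctor.Hom A.toModuleFunctor B.toModuleFunctor) {S T : Type u}
    [CommRing S] [Algebra R S] [CommRing T] [Algebra R T] (f : S →ₐ[R] T) (x : A.obj S) :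
    B.map f (appₗ φ S x) = appₗ φ T (A.map f x) := (φ.naturality f x).symm

/-- A morphism of functors of modules from `A^{**}` to a dual functor of algebras is multiplicative
if its restriction to `A` is. -/
theorem app_mul_of_toBidual (hA : A.toModuleFunctor.dual.IsReflexive)
    (hB : ModuleFunctor.IsDual.{u, w₁, w₂} B.toModuleFunctor)
    (φ : ModuleFunctor.Hom A.bidual.toModuleFunctor B.toModuleFunctor)
    (hφ : ∀ (S : Type u) [CommRing S] [Algebra R S] (x y : A.obj S),
      appₗ φ S (A.toBidual.app S (x * y)) =
        appₗ φ S (A.toBidual.app S x) * appₗ φ S (A.toBidual.app S y))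
    {S : Type u} [CommRing S] [Algebra R S] (θ θ' : A.bidual.obj S) :
    appₗ φ S (θ * θ') = appₗ φ S θ * appₗ φ S θ' := by
  -- With the left factor fixed in `A`, both sides are linear and natural in `η` over `T`-algebras
  -- and agree for `η` in `A`, hence everywhere.
  have hleft : ∀ (T : Type u) [CommRing T] [Algebra R T] (x : A.obj T) (η : A.bidual.obj T),
      appₗ φ T (A.toBidual.app T x * η) = appₗ φ T (A.toBidual.app T x) * appₗ φ T η := by
    intro T _ _ x η
    have h : (ModuleFunctor.ihomMap (ModuleFunctor.Hom.id _) φ).app T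
          (A.bidual.mulLeftOver (A.toBidual.app T x)) =
        (ModuleFunctor.ihomMap φ (ModuleFunctor.Hom.id _)).app T
          (B.mulLeftOver (appₗ φ T (A.toBidual.app T x))) :=
      ModuleFunctor.HomOver.eq_of_toBidual hA hB fun U _ _ f (y : A.obj U) => by
        change appₗ φ U (A.bidual.map f (A.toBidual.app T x) * A.toBidual.app U y) =
          B.map f (appₗ φ T (A.toBidual.app T x)) * appₗ φ U (A.toBidual.app U y)
        rw [appₗ_map, ← A.toBidual.naturality, ← hφ, map_mul (A.toBidual.app U)]
    have h₁ := congrArg (fun χ : ModuleFunctor.HomOver A.bidual.toModuleFunctor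
      B.toModuleFunctor T => χ.app T (AlgHom.id R T) η) h
    change appₗ φ T (A.bidual.map (AlgHom.id R T) (A.toBidual.app T x) * η) =
        B.map (AlgHom.id R T) (appₗ φ T (A.toBidual.app T x)) * appₗ φ T η at h₁
    rwa [A.bidual.map_id, B.map_id] at h₁
  -- Now the right factor `θ'` is fixed and the left one varies; agreement for left factors in `A`
  -- is `hleft`.
  have h : (ModuleFunctor.ihomMap (ModuleFunctor.Hom.id _) φ).app S (A.bidual.mulRightOver θ') =
      (ModuleFunctor.ihomMap φ (ModuleFunctor.Hom.id _)).app S (B.mulRightOver (appₗ φ S θ')) :=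
    ModuleFunctor.HomOver.eq_of_toBidual hA hB fun U _ _ f (x : A.obj U) => by
      change appₗ φ U (A.toBidual.app U x * A.bidual.map f θ') =
        appₗ φ U (A.toBidual.app U x) * B.map f (appₗ φ S θ')
      rw [appₗ_map]
      exact hleft U x _
  have h₁ := congrArg (fun χ : ModuleFunctor.HomOver A.bidual.toModuleFunctor
    B.toModuleFunctor S => χ.app S (AlgHom.id R S) θ) h
  change appₗ φ S (θ * A.bidual.map (AlgHom.id R S) θ') =
    appₗ φ S θ * B.map (AlgHom.id R S) (appₗ φ S θ') at h₁
  rwa [A.bidual.map_id, B.map_id] at h₁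

theorem Hom.ext_app {f g : Hom A B}
    (h : ∀ (S : Type u) [CommRing S] [Algebra R S] (x : A.obj S), f.app S x = g.app S x) :
    f = g :=
  Hom.ext <| funext fun S => funext fun _ => funext fun _ => AlgHom.ext (h S)

/-- The linear universal property gives injectivity and a linear extension; the extension preserves
the unit because that of `A^{**}` comes from `A`, and products by `app_mul_of_toBidual`. -/
theorem comp_toBidual_bijective (hA : A.toModuleFunctor.dual.IsReflexive)
    (hB : ModuleFunctor.IsDual.{u, w₁, w₂} B.toModuleFunctor) :
    Function.Bijective fun φ : Hom A.bidual B => φ.comp A.toBidual := by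
  have hbij := ModuleFunctor.comp_toBidual_bijective hA hB
  constructor
  · intro φ ψ h
    have h₁ : φ.toModuleHom = ψ.toModuleHom :=
      hbij.1 (congrArg (fun χ : Hom A B => χ.toModuleHom) h)
    exact Hom.ext_app fun S _ _ θ => congrArg (fun χ : ModuleFunctor.Hom A.bidual.toModuleFunctor
      B.toModuleFunctor => χ.app S θ) h₁
  · intro ψ
    obtain ⟨φ, hφ⟩ := hbij.2 ψ.toModuleHom
    have hφ' : ∀ (S : Type u) [CommRing S] [Algebra R S] (x : A.obj S),
        appₗ (A := A.bidual) φ S (A.toBidual.app S x) = ψ.app S x := fun S _ _ x =>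
      congrArg (fun χ : ModuleFunctor.Hom A.toModuleFunctor B.toModuleFunctor => χ.app S x) hφ
    refine ⟨⟨fun S _ _ => AlgHom.ofLinearMap (appₗ (A := A.bidual) φ S) ?_ ?_, fun f x => φ.naturality f x⟩,
      Hom.ext_app fun S _ _ x => hφ' S x⟩
    · exact (hφ' S 1).trans (map_one (ψ.app S))
    · exact app_mul_of_toBidual hA hB φ fun T _ _ x y => by
        rw [hφ', hφ', hφ', map_mul]

end Universal

end AlgebraFunctor

end

theorem theorem3p6 {R : Type u} [CommRing R] :
    (∀ M : ModuleFunctor.{u, w} R, M.IsEssentiallyFree → M.IsReflexive) ∧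
    (∀ (L : Type u) (M : L → ModuleFunctor.{u, w} R), (∀ l, (M l).IsEssentiallyFree) →
      (ModuleFunctor.prod M).IsEssentiallyFree ∧ (ModuleFunctor.directSum M).IsEssentiallyFree) ∧
    (∀ (M : ModuleFunctor.{u, w} R) (M' : ModuleFunctor.{u, w₁} R),
      M.IsEssentiallyFree → M'.IsEssentiallyFree →
      M.dual.IsEssentiallyFree ∧ (ModuleFunctor.ihom M M').IsEssentiallyFree) ∧
    (∀ (M : ModuleFunctor.{u, w} R) (M' : ModuleFunctor.{u, w₁} R),
      M.IsEssentiallyFree → M'.IsEssentiallyFree →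
      (M.tensor M').dual.IsEssentiallyFree ∧
      ∀ M'' : ModuleFunctor.{u, w₂} R, ModuleFunctor.IsDual.{u, w₂, w₃} M'' →
        Function.Bijective
          (fun φ : ModuleFunctor.Hom (M.tensor M').dual.dual M'' => φ.comp (M.tensor M').toBidual)) ∧
    (∀ (A : AlgebraFunctor.{u, w} R) (A' : AlgebraFunctor.{u, w₁} R),
      A.toModuleFunctor.IsEssentiallyFree → A'.toModuleFunctor.IsEssentiallyFree →
      (A.tensor A').toModuleFunctor.dual.dual.IsEssentiallyFree ∧
      ∃ (B : AlgebraFunctor.{u, max (u + 1) w w₁} R)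
        (e : ModuleFunctor.Hom B.toModuleFunctor
          (A.tensor A').toModuleFunctor.dual.dual)
        (ι : AlgebraFunctor.Hom (A.tensor A') B),
        e.IsIso ∧ e.comp ι.toModuleHom = (A.tensor A').toModuleFunctor.toBidual ∧
        ∀ A'' : AlgebraFunctor.{u, w₂} R, ModuleFunctor.IsDual.{u, w₂, w₃} A''.toModuleFunctor →
          Function.Bijective
            (fun φ : AlgebraFunctor.Hom B A'' => φ.comp ι)) := by
  refine ⟨fun M hM => hM.isReflexive, fun L M hM => ⟨.prod hM, .directSum hM⟩,
    fun M M' hM hM' => ⟨hM.dual, hM.ihom hM'⟩, fun M M' hM hM' => ?_, fun A A' hA hA' => ?_⟩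
  · have h := hM.tensor_dual hM'
    exact ⟨h, fun M'' hM'' => ModuleFunctor.comp_toBidual_bijective h.isReflexive hM''⟩
  · have h : (A.tensor A').toModuleFunctor.dual.IsEssentiallyFree := hA.tensor_dual hA'
    -- The functor of modules underlying `bidual` is the double dual by definition, so the identity
    -- serves as the comparison isomorphism.
    exact ⟨h.dual, (A.tensor A').bidual, ModuleFunctor.Hom.id _, (A.tensor A').toBidual,
      fun _ _ _ => Function.bijective_id, rfl,
      fun A'' hA'' => AlgebraFunctor.comp_toBidual_bijective h.isReflexive hA''⟩
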